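/- Let $(\lambda_k)_{k\ge1}$ and $(\mu_k)_{k\ge1}$ be real sequences satisfying the intertwining relations $$|\lambda_1|>|\mu_1|>|\lambda_2|>|\mu_2|>\dots>|\lambda_n|>|\mu_n|>\dots>0$$ and $\lambda_k^2\to0$ as $k\to\infty$. For a vector $p$ of a complex Hilbert space $\mathcal H$ let $pp^*$ denote the operator $x\mapsto (x,p)\,p$. Then there exists a triple $W$, $W_1$, $p$, where $W,W_1$ are bounded operators on a separable complex Hilbert space $\mathcal H$ and $p\in\mathcal H$, such that 1. $W=W^*\ge0$ is compact, $\operatorname{Ker}W=\{0\}$, and the eigenvalues of $W$ are exactly the numbers $\lambda_k^2$, $k\ge1$, each of them simple; 2. $W_1=W-pp^*$ is compact and its non-zero eigenvalues are exactly the numbers $\mu_k^2$, $k\ge1$ (the number $0$ may or may not be an eigenvalue of $W_1$). This triple is unique up to unitary equivalence: if $\widetilde W,\widetilde W_1,\widetilde p$ on $\widetilde{\mathcal H}$ is another triple with these properties, then there is a unitary operator $U:\mathcal H\to\widetilde{\mathcal H}$ with $\widetilde W=UWU^*$, $\widetilde W_1=UW_1U^*$, $\widetilde p=Up$. All eigenvalues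 of $W_1$ (including $0$, if it is an eigenvalue) are simple. For an injective operator $A$ put $\|A^{-1}p\|=\|q\|$ if $p=Aq$, and $\|A^{-1}p\|=\infty$ if $p\notin\operatorname{Ran}A$. Then $$\|W^{-1/2}p\|=1\quad\Longleftrightarrow\quad \sum_{j=1}^\infty\left(1-\frac{\mu_j^2}{\lambda_j^2}\right)=\infty ,$$ and, if this holds, then $$\|W^{-1}p\|=\infty\ \ (\text{i.e. } p\notin\operatorname{Ran}W)\quad\Longleftrightarrow\quad \sum_{j=1}^\infty\left(\frac{\mu_j^2}{\lambda_{j+1}^2}-1\right)=\infty .$$ -/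

import Mathlib

open Filter Topology

/-- Extended norm `‖A⁻¹ p‖ ∈ [0, ∞]` for an injective operator `A`, where `A⁻¹` is the (possibly
unbounded) inverse with domain `Ran A`: it is `‖q‖` if `p = A q`, and `∞` if `p ∉ Ran A`. -/
noncomputable def normInv {H : Type*} [NormedAddCommGroup H] [InnerProductSpace ℂ H]
    (A : H →L[ℂ] H) (p : H) : ENNReal :=
  ⨅ (q : H) (_ : A q = p), ‖q‖ₑ

/-- The triple `W`, `W₁ = W - p p^*`, `p` on `H`, where `W ≥ 0` is compact and injective, with
simple eigenvalues exactly the `lam k ^ 2`, and `W₁` is compact with nonzero eigenvalues exactly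
the `mu k ^ 2` (zero may or may not be an eigenvalue of `W₁`). -/
structure IsBorgTriple {H : Type*} [NormedAddCommGroup H] [InnerProductSpace ℂ H]
    [CompleteSpace H] (lam mu : ℕ → ℝ) (W W₁ : H →L[ℂ] H) (p : H) : Prop where
  isPositive : W.IsPositive
  ker_eq_bot : (W : H →ₗ[ℂ] H).ker = ⊥
  isCompact : IsCompactOperator W
  hasEigenvalue_iff : ∀ z : ℂ,
    Module.End.HasEigenvalue (W : H →ₗ[ℂ] H) z ↔ ∃ k, z = ((lam k ^ 2 : ℝ) : ℂ)
  simple : ∀ k,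
    Module.finrank ℂ (Module.End.eigenspace (W : H →ₗ[ℂ] H) ((lam k ^ 2 : ℝ) : ℂ)) = 1
  eq_sub : W₁ = W - InnerProductSpace.rankOne ℂ p p
  isCompact₁ : IsCompactOperator W₁
  hasEigenvalue₁_iff : ∀ z : ℂ, z ≠ 0 →
    (Module.End.HasEigenvalue (W₁ : H →ₗ[ℂ] H) z ↔ ∃ k, z = ((mu k ^ 2 : ℝ) : ℂ))

/-- Unitary equivalence of triples: `R' = U R U^*`, `R₁' = U R₁ U^*`, `p' = U p` for some unitary
operator `U : H → H'`. -/
def TripleUnitaryEquiv {H H' : Type*} [NormedAddCommGroup H] [InnerProductSpace ℂ H]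
    [NormedAddCommGroup H'] [InnerProductSpace ℂ H']
    (R R₁ : H →L[ℂ] H) (p : H) (R' R₁' : H' →L[ℂ] H') (p' : H') : Prop :=
  ∃ U : H ≃ₗᵢ[ℂ] H',
    (∀ y, R' y = U (R (U.symm y))) ∧ (∀ y, R₁' y = U (R₁ (U.symm y))) ∧ p' = U p

/-- The series `∑ a j` diverges to `+∞`. -/
def SumEqTop (a : ℕ → ℝ) : Prop :=
  Tendsto (fun n => ∑ j ∈ Finset.range n, a j) atTop atTop

/-! Write `a k = lam k ^ 2`, `b k = mu k ^ 2`. In an eigenbasis of `W`, put `r k = |p_k|²`. A number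
`z ≠ 0` off the spectrum of `W` is an eigenvalue of `W - p p^*` iff `F z = 1 - ∑ r k / (a k - z)`
vanishes (`IsDiagonal.hasEigenvalue_sub_rankOne_iff`). So `F` has poles `a k` and zeros `b k`, which
suggests `F z = ∏ (b j - z) / (a j - z)`, and the triple is encoded by the residues of this product.

Existence: interlacing makes the residues of the finite products positive and increasing, with `∑ r
k / a k ≤ 1`; dominated convergence gives the infinite expansion (`tendsto_prod`), whose nonzero
real zeros off the poles are the `b k`.

Uniqueness: `W₁` has no negative eigenvalue, so again `∑ r k / a k ≤ 1`. Cancelling finitely many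
zeros and poles of `F` then pins each `r k` to the residue of the product (`eq_limitWeight`). Once
the phases of the eigenvectors are normalised, the coordinates of `p` are determined.

Norms: `‖W^{-1/2} p‖² = ∑ r k / a k` and `‖W⁻¹ p‖² = ∑ r k / a k ^ 2`. Letting `z = -t` tend to `0`
from the left, the first is `1 - ∏ b j / a j`; if it equals `1`, the second is `(1 / a 0) ∏ b j / a
(j + 1)`. Convergence of these products is convergence of the two series. -/

/-- Two sequences interlace and decrease to zero: `a 0 > b 0 > a 1 > b 1 > ⋯ > 0`. -/
structure InterlacesToZero (a b : ℕ → ℝ) : Prop where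
  lt : ∀ k, b k < a k
  succ_lt : ∀ k, a (k + 1) < b k
  pos : ∀ k, 0 < b k
  lim : Tendsto a atTop (𝓝 0)

/-! ### Partial fractions of finite products -/

/-- The residues of the finite product `∏ j < N, (b j - z) / (a j - z)`. -/
noncomputable def cauchyWeight (a b : ℕ → ℝ) (N k : ℕ) : ℝ :=
  (a k - b k) * ∏ j ∈ (Finset.range N).erase k, (b j - a k) / (a j - a k)

/-- The residues of the infinite product `∏ j, (b j - z) / (a j - z)`. -/
noncomputable def limitWeight (a b : ℕ → ℝ) (k : ℕ) : ℝ :=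
  -- The shift matters: for interlacing sequences, only factors with index above `k` are at least
  -- `1`, so monotonicity in the number of factors starts at `k + 1`.
  ⨆ N, cauchyWeight a b (N + (k + 1)) k

theorem cauchyWeight_self (a b : ℕ → ℝ) (N : ℕ) :
    cauchyWeight a b (N + 1) N =
      (a N - b N) * ∏ j ∈ Finset.range N, (b j - a N) / (a j - a N) := by
  rw [cauchyWeight, Finset.range_add_one, Finset.erase_insert (by simp)]

theorem cauchyWeight_succ (a b : ℕ → ℝ) {N k : ℕ} (hk : k < N) :
    cauchyWeight a b (N + 1) k =
      (b N - a k) / (a N - a k) * cauchyWeight a b N k := by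
  rw [cauchyWeight, cauchyWeight, Finset.range_add_one, Finset.erase_insert_of_ne hk.ne',
    Finset.prod_insert (by simp)]
  ring

/-- Partial fraction expansion of `∏ j < N, (b j - z) / (a j - z)`. -/
theorem prod_div_eq_one_sub_sum {a : ℕ → ℝ} (b : ℕ → ℝ) (ha : Function.Injective a) (N : ℕ) :
    ∀ z, (∀ k < N, a k ≠ z) → ∏ j ∈ Finset.range N, (b j - z) / (a j - z) =
      1 - ∑ k ∈ Finset.range N, cauchyWeight a b N k / (a k - z) := by
  induction N with
  | zero => simp
  | succ N ih =>
    intro z hz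
    have h1 := ih z (fun k hk => hz k (by omega))
    -- The expansion at `z = a N` evaluates the residue at the new pole; this is why the induction
    -- is over all `z`.
    have h2 := ih (a N) (fun k hk => ha.ne hk.ne)
    have hN : a N - z ≠ 0 := sub_ne_zero.2 (hz N (by omega))
    rw [Finset.prod_range_succ, Finset.sum_range_succ, cauchyWeight_self, h1, h2]
    have h3 : ∀ k ∈ Finset.range N, cauchyWeight a b (N + 1) k / (a k - z) =
        (b N - z) / (a N - z) * (cauchyWeight a b N k / (a k - z)) +
          (a N - b N) / (a N - z) * (cauchyWeight a b N k / (a k - a N)) := by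
      intro k hk
      have hk := Finset.mem_range.1 hk
      have h4 : a k - z ≠ 0 := sub_ne_zero.2 (hz k (by omega))
      have h5 : a N - a k ≠ 0 := sub_ne_zero.2 (ha.ne hk.ne')
      have h6 : a k - a N ≠ 0 := sub_ne_zero.2 (ha.ne hk.ne)
      rw [cauchyWeight_succ a b hk, show a k - a N = -(a N - a k) by ring]
      field_simp
      ring
    rw [Finset.sum_congr rfl h3, Finset.sum_add_distrib, ← Finset.mul_sum, ← Finset.mul_sum]
    generalize ∑ k ∈ Finset.range N, cauchyWeight a b N k / (a k - z) = s
    generalize ∑ k ∈ Finset.range N, cauchyWeight a b N k / (a k - a N) = t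
    field_simp
    ring

/-! ### Interlacing and passage to the infinite product -/

namespace InterlacesToZero

variable {a b : ℕ → ℝ}

theorem strictAnti (h : InterlacesToZero a b) : StrictAnti a :=
  strictAnti_nat_of_succ_lt fun k => (h.succ_lt k).trans (h.lt k)

theorem pos_left (h : InterlacesToZero a b) (k : ℕ) : 0 < a k := (h.pos k).trans (h.lt k)

theorem lt_of_lt (h : InterlacesToZero a b) {i j : ℕ} (hij : i < j) : a j < b i :=
  (h.strictAnti.antitone (Nat.succ_le_of_lt hij)).trans_lt (h.succ_lt i)

theorem lt_of_le (h : InterlacesToZero a b) {i j : ℕ} (hij : i ≤ j) : b j < a i :=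
  (h.lt j).trans_le (h.strictAnti.antitone hij)

theorem ne (h : InterlacesToZero a b) (i j : ℕ) : a i ≠ b j := by
  rcases lt_or_ge j i with hij | hij
  · exact (h.lt_of_lt hij).ne
  · exact (h.lt_of_le hij).ne'

theorem strictAnti_right (h : InterlacesToZero a b) : StrictAnti b :=
  strictAnti_nat_of_succ_lt fun k => (h.lt (k + 1)).trans (h.succ_lt k)

theorem lim_right (h : InterlacesToZero a b) : Tendsto b atTop (𝓝 0) :=
  squeeze_zero (fun k => (h.pos k).le) (fun k => (h.lt k).le) h.lim

theorem factor_pos (h : InterlacesToZero a b) {j k : ℕ} (hjk : j ≠ k) :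
    0 < (b j - a k) / (a j - a k) := by
  rcases lt_or_gt_of_ne hjk with hjk | hjk
  · exact div_pos (sub_pos.2 (h.lt_of_lt hjk)) (sub_pos.2 (h.strictAnti hjk))
  · exact div_pos_of_neg_of_neg (sub_neg.2 (h.lt_of_le hjk.le)) (sub_neg.2 (h.strictAnti hjk))

theorem cauchyWeight_pos (h : InterlacesToZero a b) (N k : ℕ) : 0 < cauchyWeight a b N k :=
  mul_pos (sub_pos.2 (h.lt k))
    (Finset.prod_pos fun _ hj => h.factor_pos (Finset.ne_of_mem_erase hj))

/-- The new factor is at least `1` because `b N < a N < a k`. Hence the residues converge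
monotonically. -/
theorem cauchyWeight_le_succ (h : InterlacesToZero a b) {N k : ℕ} (hk : k < N) :
    cauchyWeight a b N k ≤ cauchyWeight a b (N + 1) k := by
  rw [cauchyWeight_succ a b hk]
  refine le_mul_of_one_le_left (h.cauchyWeight_pos N k).le ?_
  rw [one_le_div_of_neg (sub_neg.2 (h.strictAnti hk))]
  linarith [h.lt N]

theorem prod_eq (h : InterlacesToZero a b) (N : ℕ) : ∏ j ∈ Finset.range N, b j / a j =
      1 - ∑ k ∈ Finset.range N, cauchyWeight a b N k / a k := by
  simpa using prod_div_eq_one_sub_sum b h.strictAnti.injective N 0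
    (fun k _ => (h.pos_left k).ne')

/-- At `z = 0` the expansion equals a positive product, so the full sum is below `1`, and its terms
are positive. This bound gives summability in the limit. -/
theorem sum_cauchyWeight_div_le (h : InterlacesToZero a b) {n N : ℕ} (hn : n ≤ N) :
    ∑ k ∈ Finset.range n, cauchyWeight a b N k / a k ≤ 1 := by
  have h1 : 0 < ∏ j ∈ Finset.range N, b j / a j :=
    Finset.prod_pos fun j _ => div_pos (h.pos j) (h.pos_left j)
  have h2 : ∑ k ∈ Finset.range n, cauchyWeight a b N k / a k ≤
      ∑ k ∈ Finset.range N, cauchyWeight a b N k / a k :=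
    Finset.sum_le_sum_of_subset_of_nonneg (Finset.range_mono hn)
      fun k _ _ => (div_pos (h.cauchyWeight_pos N k) (h.pos_left k)).le
  linarith [h.prod_eq N]

theorem cauchyWeight_le (h : InterlacesToZero a b) {N k : ℕ} (hk : k < N) :
    cauchyWeight a b N k ≤ a k := by
  have h1 := h.sum_cauchyWeight_div_le (le_refl N)
  have h2 : cauchyWeight a b N k / a k ≤ 1 :=
    (Finset.single_le_sum (f := fun k => cauchyWeight a b N k / a k)
      (fun i _ => (div_pos (h.cauchyWeight_pos N i) (h.pos_left i)).le)
      (Finset.mem_range.2 hk)).trans h1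
  rwa [div_le_one (h.pos_left k)] at h2

theorem monotone_cauchyWeight (h : InterlacesToZero a b) (k : ℕ) :
    Monotone fun N => cauchyWeight a b (N + (k + 1)) k :=
  monotone_nat_of_le_succ fun N => by
    have := h.cauchyWeight_le_succ (N := N + (k + 1)) (k := k) (by omega)
    rwa [add_right_comm] at this

theorem bddAbove_cauchyWeight (h : InterlacesToZero a b) (k : ℕ) :
    BddAbove (Set.range fun N => cauchyWeight a b (N + (k + 1)) k) :=
  ⟨a k, by rintro _ ⟨N, rfl⟩; exact h.cauchyWeight_le (by omega)⟩

theorem tendsto_cauchyWeight (h : InterlacesToZero a b) (k : ℕ) :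
    Tendsto (fun N => cauchyWeight a b N k) atTop (𝓝 (limitWeight a b k)) :=
  (tendsto_add_atTop_iff_nat (k + 1)).1
    (tendsto_atTop_ciSup (h.monotone_cauchyWeight k) (h.bddAbove_cauchyWeight k))

theorem cauchyWeight_le_limitWeight (h : InterlacesToZero a b) {N k : ℕ} (hk : k < N) :
    cauchyWeight a b N k ≤ limitWeight a b k := by
  obtain ⟨m, rfl⟩ := Nat.exists_eq_add_of_lt hk
  have := le_ciSup (h.bddAbove_cauchyWeight k) m
  rwa [show m + (k + 1) = k + m + 1 by ring] at this

theorem limitWeight_pos (h : InterlacesToZero a b) (k : ℕ) : 0 < limitWeight a b k :=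
  (h.cauchyWeight_pos (k + 1) k).trans_le (h.cauchyWeight_le_limitWeight (Nat.lt_succ_self k))

theorem limitWeight_div_nonneg (h : InterlacesToZero a b) (k : ℕ) : 0 ≤ limitWeight a b k / a k :=
  (div_pos (h.limitWeight_pos k) (h.pos_left k)).le

theorem sum_limitWeight_div_le (h : InterlacesToZero a b) (n : ℕ) :
    ∑ k ∈ Finset.range n, limitWeight a b k / a k ≤ 1 :=
  le_of_tendsto (tendsto_finsetSum _ fun k _ => (h.tendsto_cauchyWeight k).div_const (a k))
    ((eventually_ge_atTop n).mono fun _ hN => h.sum_cauchyWeight_div_le hN)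

theorem summable_limitWeight_div (h : InterlacesToZero a b) :
    Summable fun k => limitWeight a b k / a k :=
  summable_of_sum_range_le h.limitWeight_div_nonneg h.sum_limitWeight_div_le

theorem tsum_limitWeight_div_le (h : InterlacesToZero a b) :
    ∑' k, limitWeight a b k / a k ≤ 1 :=
  Real.tsum_le_of_sum_range_le h.limitWeight_div_nonneg h.sum_limitWeight_div_le

theorem exists_abs_div_sub_le (h : InterlacesToZero a b) {z : ℝ} (hz : z ≠ 0) :
    ∃ C, ∀ k, |a k / (a k - z)| ≤ C := by
  have h1 : Tendsto (fun k => a k / (a k - z)) atTop (𝓝 (0 / (0 - z))) :=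
    h.lim.div (h.lim.sub_const z) (by simpa using hz)
  obtain ⟨C, hC⟩ := (Metric.isBounded_range_of_tendsto _ h1).exists_norm_le
  exact ⟨C, fun k => hC _ ⟨k, rfl⟩⟩

theorem summable_div_sub (h : InterlacesToZero a b) {r : ℕ → ℝ}
    (hr : Summable fun k => r k / a k) {z : ℝ} (hz : z ≠ 0) :
    Summable fun k => r k / (a k - z) := by
  obtain ⟨C, hC⟩ := h.exists_abs_div_sub_le hz
  refine Summable.of_norm_bounded (hr.abs.mul_right C) fun k => ?_
  have : r k / (a k - z) = r k / a k * (a k / (a k - z)) := by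
    have := (h.pos_left k).ne'
    rw [div_mul_div_cancel₀ this]
  rw [this, norm_mul, Real.norm_eq_abs, Real.norm_eq_abs]
  exact mul_le_mul_of_nonneg_left (hC k) (abs_nonneg _)

/-- Partial fraction expansion of the infinite product `∏ j, (b j - z) / (a j - z)`. -/
theorem tendsto_prod (h : InterlacesToZero a b) {z : ℝ} (hz : z ≠ 0) (hza : ∀ k, a k ≠ z) :
    Tendsto (fun N => ∏ j ∈ Finset.range N, (b j - z) / (a j - z)) atTop
      (𝓝 (1 - ∑' k, limitWeight a b k / (a k - z))) := by
  simp_rw [fun N => prod_div_eq_one_sub_sum b h.strictAnti.injective N z fun k _ => hza k]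
  refine Tendsto.const_sub 1 ?_
  obtain ⟨C, hC⟩ := h.exists_abs_div_sub_le hz
  -- The finite residues are dominated by their limits, and `a k / (a k - z)` is bounded because `a
  -- k → 0 ≠ z`.
  have h1 := tendsto_tsum_of_dominated_convergence
    (f := fun N k => if k < N then cauchyWeight a b N k / (a k - z) else 0)
    (g := fun k => limitWeight a b k / (a k - z)) (𝓕 := atTop)
    (h.summable_limitWeight_div.mul_right C) (fun k => by
      refine ((h.tendsto_cauchyWeight k).div_const _).congr' ?_
      filter_upwards [eventually_gt_atTop k] with N hN
      rw [if_pos hN]) (Eventually.of_forall fun N k => by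
      have hC0 : 0 ≤ C := (abs_nonneg _).trans (hC k)
      split_ifs with hk
      · have : cauchyWeight a b N k / (a k - z) =
            cauchyWeight a b N k / a k * (a k / (a k - z)) := by
          rw [div_mul_div_cancel₀ (h.pos_left k).ne']
        rw [this, norm_mul, Real.norm_eq_abs, Real.norm_eq_abs,
          abs_of_pos (div_pos (h.cauchyWeight_pos N k) (h.pos_left k))]
        refine mul_le_mul ?_ (hC k) (abs_nonneg _) (h.limitWeight_div_nonneg k)
        exact div_le_div_of_nonneg_right (h.cauchyWeight_le_limitWeight hk) (h.pos_left k).le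
      · simpa using mul_nonneg (h.limitWeight_div_nonneg k) hC0)
  refine h1.congr fun N => ?_
  rw [tsum_eq_sum (s := Finset.range N) fun k hk => if_neg (by simpa using hk)]
  exact Finset.sum_congr rfl fun k hk => if_pos (Finset.mem_range.1 hk)

/-- The real zeros of the infinite product `∏ j, (b j - z) / (a j - z)`. -/
theorem hasSum_limitWeight_iff (h : InterlacesToZero a b) {z : ℝ} (hz : z ≠ 0)
    (hza : ∀ k, a k ≠ z) :
    HasSum (fun k => limitWeight a b k / (a k - z)) 1 ↔ ∃ k, z = b k := by
  have hs := h.summable_div_sub h.summable_limitWeight_div hz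
  have ht := h.tendsto_prod hz hza
  rw [hs.hasSum_iff]
  constructor
  · intro h1
    by_contra! hb
    -- For `z < 0` the sum is strictly below its value at `0`, which is at most `1`. For `z > 0` all
    -- but finitely many factors are at least `1` in absolute value, since eventually `b j < a j <
    -- z`; a product without zero factors then stays away from `0`.
    rcases lt_or_gt_of_ne hz with hz0 | hz0
    · refine absurd h1 (ne_of_lt (lt_of_lt_of_le ?_ h.tsum_limitWeight_div_le))
      refine Summable.tsum_lt_tsum (i := 0) (fun k => ?_) ?_ hs h.summable_limitWeight_div
      · exact div_le_div_of_nonneg_left (h.limitWeight_pos k).le (h.pos_left k) (by linarith)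
      · exact div_lt_div_of_pos_left (h.limitWeight_pos 0) (h.pos_left 0) (by linarith)
    · obtain ⟨M, hM⟩ := eventually_atTop.1 (h.lim.eventually_lt_const hz0)
      have h2 : Tendsto (fun N => |∏ j ∈ Finset.range N, (b j - z) / (a j - z)|) atTop (𝓝 0) := by
        simpa [h1] using ht.abs
      have h3 : 0 < |∏ j ∈ Finset.range M, (b j - z) / (a j - z)| := by
        rw [abs_pos, Finset.prod_ne_zero_iff]
        exact fun j _ => div_ne_zero (sub_ne_zero.2 (hb j).symm) (sub_ne_zero.2 (hza j))
      refine absurd (ge_of_tendsto h2 ((eventually_ge_atTop M).mono fun N hN => ?_)) h3.not_ge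
      rw [← Finset.prod_range_mul_prod_Ico _ hN, abs_mul]
      refine le_mul_of_one_le_right (abs_nonneg _) ?_
      rw [Finset.abs_prod]
      rw [← Finset.prod_const_one (s := Finset.Ico M N)]
      refine Finset.prod_le_prod (fun _ _ => zero_le_one) fun j hj => ?_
      have h4 := hM j (Finset.mem_Ico.1 hj).1
      rw [abs_of_pos (div_pos_of_neg_of_neg (by linarith [h.lt j]) (by linarith)),
        one_le_div_of_neg (by linarith)]
      linarith [h.lt j]
  · rintro ⟨m, rfl⟩
    have h0 : Tendsto (fun N => ∏ j ∈ Finset.range N, (b j - b m) / (a j - b m)) atTop (𝓝 0) := by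
      refine tendsto_const_nhds.congr' ?_
      filter_upwards [eventually_gt_atTop m] with N hN
      exact (Finset.prod_eq_zero (Finset.mem_range.2 hN) (by simp)).symm
    linarith [tendsto_nhds_unique ht h0]

end InterlacesToZero

/-! ### Cancelling zeros of a partial fraction series -/

/-- Multiplying the partial fraction series `1 - ∑ r i / (a i - z)` by factors
`(α j - z) / (b j - z)` that cancel its zeros `b j` modifies the residues only. -/
theorem hasSum_mul_prod_div_sub {a b r : ℕ → ℝ} (α : ℕ → ℝ) (hb : Function.Injective b)
    (hab : ∀ i j, a i ≠ b j) (S : Finset ℕ)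
    (h0 : ∀ j ∈ S, HasSum (fun i => r i / (a i - b j)) 1) :
    ∀ z s, (∀ i, a i ≠ z) → (∀ j ∈ S, b j ≠ z) → HasSum (fun i => r i / (a i - z)) s →
      HasSum (fun i => (r i * ∏ j ∈ S, (α j - a i) / (b j - a i)) / (a i - z))
        (1 - (1 - s) * ∏ j ∈ S, (α j - z) / (b j - z)) := by
  induction S using Finset.induction_on with
  | empty => simp
  | insert m S hm ih =>
    intro z s hz hbz hs
    have ih := ih fun j hj => h0 j (Finset.mem_insert_of_mem hj)
    have h1 := ih z s hz (fun j hj => hbz j (Finset.mem_insert_of_mem hj)) hs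
    have h2 := ih (b m) 1 (fun i => hab i m)
      (fun j hj => hb.ne fun hjm => hm (hjm ▸ hj)) (h0 m (Finset.mem_insert_self _ _))
    have hbm : b m - z ≠ 0 := sub_ne_zero.2 (hbz m (Finset.mem_insert_self _ _))
    -- Splitting `(α m - a i) / ((b m - a i) (a i - z))` into simple fractions in `a i` produces
    -- this combination of the series at `z` and at `b m`; the latter sums to `1` by `h0`.
    have h3 := (h1.mul_left ((α m - z) / (b m - z))).sub
      (h2.mul_left ((α m - b m) / (b m - z)))
    simp only [Finset.prod_insert hm]
    have h4 : 1 - (1 - s) * ((α m - z) / (b m - z) * ∏ j ∈ S, (α j - z) / (b j - z)) =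
        (α m - z) / (b m - z) * (1 - (1 - s) * ∏ j ∈ S, (α j - z) / (b j - z)) -
          (α m - b m) / (b m - z) * (1 - (1 - 1) * ∏ j ∈ S, (α j - b m) / (b j - b m)) := by
      generalize ∏ j ∈ S, (α j - z) / (b j - z) = P
      field_simp
      ring
    rw [h4]
    refine (iff_of_eq (congrArg (fun f => HasSum f _) (funext fun i => ?_))).1 h3
    have h4 : a i - z ≠ 0 := sub_ne_zero.2 (hz i)
    have h5 : b m - a i ≠ 0 := sub_ne_zero.2 (hab i m).symm
    generalize ∏ j ∈ S, (α j - a i) / (b j - a i) = P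
    rw [show a i - b m = -(b m - a i) by ring]
    field_simp
    ring

/-! ### Convergence of series and bounds on partial products -/

theorem not_sumEqTop_iff {x : ℕ → ℝ} (hx : ∀ j, 0 ≤ x j) : ¬ SumEqTop x ↔ Summable x := by
  rw [SumEqTop, ← not_summable_iff_tendsto_nat_atTop_of_nonneg hx, not_not]

theorem summable_iff_exists_le_prod_one_sub {x : ℕ → ℝ} (h0 : ∀ j, 0 ≤ x j)
    (h1 : ∀ j, x j < 1) :
    Summable x ↔ ∃ c > 0, ∀ N, c ≤ ∏ j ∈ Finset.range N, (1 - x j) := by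
  constructor
  · intro hx
    have hl : Summable fun j => Real.log (1 + -x j) :=
      Real.summable_log_one_add_of_summable hx.neg
    refine ⟨Real.exp (∑' j, Real.log (1 + -x j)), Real.exp_pos _, fun N => ?_⟩
    have h2 : ∏ j ∈ Finset.range N, (1 - x j) =
        Real.exp (∑ j ∈ Finset.range N, Real.log (1 + -x j)) := by
      rw [Real.exp_sum]
      refine Finset.prod_congr rfl fun j _ => ?_
      rw [← sub_eq_add_neg, Real.exp_log (by linarith [h1 j])]
    rw [h2, Real.exp_le_exp, ← neg_le_neg_iff, ← Finset.sum_neg_distrib, ← tsum_neg]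
    refine hl.neg.sum_le_tsum _ fun j _ => neg_nonneg.2 (Real.log_nonpos ?_ ?_)
    · linarith [h1 j]
    · linarith [h0 j]
  · rintro ⟨c, hc, h⟩
    refine summable_of_sum_range_le (c := -Real.log c) h0 fun N => ?_
    have h2 : ∏ j ∈ Finset.range N, (1 - x j) ≤ Real.exp (-∑ j ∈ Finset.range N, x j) := by
      rw [← Finset.sum_neg_distrib, Real.exp_sum]
      exact Finset.prod_le_prod (fun j _ => by linarith [h1 j])
        fun j _ => Real.one_sub_le_exp_neg (x j)
    have h3 := (Real.log_le_iff_le_exp hc).2 ((h N).trans h2)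
    linarith

theorem summable_iff_exists_prod_one_add_le {x : ℕ → ℝ} (h0 : ∀ j, 0 ≤ x j) :
    Summable x ↔ ∃ C, ∀ N, ∏ j ∈ Finset.range N, (1 + x j) ≤ C := by
  constructor
  · intro hx
    refine ⟨Real.exp (∑' j, x j), fun N => ?_⟩
    refine le_trans ?_ (Real.exp_le_exp.2 (hx.sum_le_tsum (Finset.range N) fun j _ => h0 j))
    rw [Real.exp_sum]
    refine Finset.prod_le_prod (fun j _ => by linarith [h0 j]) fun j _ => ?_
    linarith [Real.add_one_le_exp (x j)]
  · rintro ⟨C, h⟩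
    refine summable_of_sum_range_le (c := C) h0 fun N => le_trans ?_ (h N)
    have h1 : ∑ j ∈ Finset.range N, x j + 1 ≤ ∏ j ∈ Finset.range N, (1 + x j) := by
      induction N with
      | zero => simp
      | succ N ih =>
        rw [Finset.prod_range_succ, Finset.sum_range_succ]
        have h2 : 0 ≤ ∑ j ∈ Finset.range N, x j := Finset.sum_nonneg fun j _ => h0 j
        nlinarith [h0 N]
    linarith

/-! ### Uniqueness of the residues and the two summability criteria -/

namespace InterlacesToZero

variable {a b : ℕ → ℝ}

/-- The residues `r` are determined by the zeros of `1 - ∑ r i / (a i - z)`. -/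
theorem eq_limitWeight (h : InterlacesToZero a b) {r : ℕ → ℝ} (hr : ∀ k, 0 ≤ r k)
    (hs : Summable fun k => r k / a k) (hs1 : ∑' k, r k / a k ≤ 1)
    (hb : ∀ j, HasSum (fun k => r k / (a k - b j)) 1) (k : ℕ) : r k = limitWeight a b k := by
  have key : ∀ N, k < N → 0 ≤ r k / cauchyWeight a b N k - 1 ∧
      r k / cauchyWeight a b N k - 1 ≤ a N / (b k - a N) := by
    intro N hkN
    set S := (Finset.range N).erase k with hS
    -- Multiplying by `(a j - z) / (b j - z)`, `j ∈ S`, removes all poles with index below `N`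
    -- except `a k`. At `z = b k` what remains is `r k / cauchyWeight a b N k` plus a tail over `i ≥
    -- N` summing to `1`; at `z = 0` the same series is at most `1` and controls the tail.
    set T : ℕ → ℝ := fun i => r i * ∏ j ∈ S, (a j - a i) / (b j - a i) with hT
    have hT0 : ∀ i < N, i ≠ k → T i = 0 := fun i hi hik =>
      mul_eq_zero_of_right _ (Finset.prod_eq_zero
        (Finset.mem_erase.2 ⟨hik, Finset.mem_range.2 hi⟩) (by simp))
    have hfac : ∀ j i, j ≠ i → 0 ≤ (a j - a i) / (b j - a i) := fun j i hji => by
      have := (h.factor_pos hji).le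
      rw [← inv_div]
      exact inv_nonneg.2 this
    have hTnn : ∀ i, 0 ≤ T i := fun i => by
      by_cases hi : i < N ∧ i ≠ k
      · exact (hT0 i hi.1 hi.2).ge
      · refine mul_nonneg (hr i) (Finset.prod_nonneg fun j hj => hfac j i ?_)
        rintro rfl
        have hj := Finset.mem_erase.1 hj
        exact hi ⟨Finset.mem_range.1 hj.2, hj.1⟩
    have h1 : HasSum (fun i => T i / (a i - b k)) 1 := by
      simpa only [sub_self, zero_mul, sub_zero] using
        hasSum_mul_prod_div_sub a h.strictAnti_right.injective h.ne S
          (fun j _ => hb j) (b k) 1 (fun i => h.ne i k)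
          (fun j hj => h.strictAnti_right.injective.ne (Finset.ne_of_mem_erase hj)) (hb k)
    have h2 : HasSum (fun i => T i / a i)
        (1 - (1 - ∑' k, r k / a k) * ∏ j ∈ S, a j / b j) := by
      simpa only [sub_zero] using
        hasSum_mul_prod_div_sub a h.strictAnti_right.injective h.ne S
          (fun j _ => hb j) 0 (∑' k, r k / a k) (fun i => (h.pos_left i).ne')
          (fun j _ => (h.pos j).ne') (by simpa only [sub_zero] using hs.hasSum)
    have h2' : 1 - (1 - ∑' k, r k / a k) * ∏ j ∈ S, a j / b j ≤ 1 := by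
      have : 0 ≤ ∏ j ∈ S, a j / b j :=
        Finset.prod_nonneg fun j _ => (div_pos (h.pos_left j) (h.pos j)).le
      have := mul_nonneg (sub_nonneg.2 hs1) this
      linarith
    have hk : T k / (a k - b k) = r k / cauchyWeight a b N k := by
      rw [cauchyWeight, ← hS, hT]
      simp only [Finset.prod_div_distrib]
      rw [mul_div_assoc', mul_div_assoc', div_div, div_div_eq_mul_div, mul_comm (a k - b k)]
    have h3 : HasSum (fun i => (if i = k then T k / (a k - b k) else 0) - T i / (a i - b k))
        (T k / (a k - b k) - 1) := (hasSum_ite_eq k _).sub h1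
    have hN := h.lt_of_lt hkN
    have hc : 0 ≤ a N / (b k - a N) := (div_pos (h.pos_left N) (sub_pos.2 hN)).le
    -- For `i ≥ N`, `a i ≤ a N < b k`, so the tail terms at `b k` are nonpositive and bounded by `a
    -- N / (b k - a N)` times those at `0`. This constant tends to `0`.
    have hterm : ∀ i, 0 ≤ (if i = k then T k / (a k - b k) else 0) - T i / (a i - b k) ∧
        (if i = k then T k / (a k - b k) else 0) - T i / (a i - b k) ≤
          a N / (b k - a N) * (T i / a i) := by
      intro i
      have hTa : 0 ≤ T i / a i := div_nonneg (hTnn i) (h.pos_left i).le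
      by_cases hik : i = k
      · subst hik
        simpa using mul_nonneg hc hTa
      · rw [if_neg hik, zero_sub]
        by_cases hiN : i < N
        · simp [hT0 i hiN hik]
        · have hai : a i ≤ a N := h.strictAnti.antitone (not_lt.1 hiN)
          have hpi := h.pos_left i
          have e : -(T i / (a i - b k)) = a i / (b k - a i) * (T i / a i) := by
            have : b k - a i ≠ 0 := by linarith
            rw [show a i - b k = -(b k - a i) by ring]
            field_simp
          rw [e]
          refine ⟨mul_nonneg (div_nonneg hpi.le (by linarith)) hTa,
            mul_le_mul_of_nonneg_right ?_ hTa⟩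
          exact div_le_div₀ (h.pos_left N).le hai (by linarith) (by linarith)
    rw [← hk]
    refine ⟨h3.nonneg fun i => (hterm i).1, ?_⟩
    exact (hasSum_le (fun i => (hterm i).2) h3 (h2.mul_left _)).trans
      (mul_le_of_le_one_right hc h2')
  have hlim : Tendsto (fun N => a N / (b k - a N)) atTop (𝓝 0) := by
    have := h.lim.div (h.lim.const_sub (b k)) (by simpa using (h.pos k).ne')
    rwa [zero_div] at this
  have h4 : Tendsto (fun N => r k / cauchyWeight a b N k - 1) atTop (𝓝 0) :=
    tendsto_of_tendsto_of_tendsto_of_le_of_le' tendsto_const_nhds hlim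
      ((eventually_gt_atTop k).mono fun N hN => (key N hN).1)
      ((eventually_gt_atTop k).mono fun N hN => (key N hN).2)
  have hpos := h.limitWeight_pos k
  have h5 : Tendsto (fun N => r k / cauchyWeight a b N k - 1) atTop
      (𝓝 (r k / limitWeight a b k - 1)) :=
    (tendsto_const_nhds.div (h.tendsto_cauchyWeight k) hpos.ne').sub_const 1
  have h6 := tendsto_nhds_unique h5 h4
  have h7 : r k / limitWeight a b k = 1 := by linarith
  exact (div_eq_one_iff_eq hpos.ne').1 h7

/-- A bound for sums `∑ c k / (a k + t)`, `t > 0`, that is continuous in `t` passes to `t = 0`. -/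
theorem sum_div_le_of_forall_pos (h : InterlacesToZero a b) {c : ℕ → ℝ} {B : ℝ} {n : ℕ}
    (hB : ∀ t > 0, ∑ k ∈ Finset.range n, c k / (a k + t) ≤ B) :
    ∑ k ∈ Finset.range n, c k / a k ≤ B := by
  have h1 : Tendsto (fun t => ∑ k ∈ Finset.range n, c k / (a k + t)) (𝓝[>] (0 : ℝ))
      (𝓝 (∑ k ∈ Finset.range n, c k / a k)) := by
    refine tendsto_finsetSum _ fun k _ => tendsto_nhdsWithin_of_tendsto_nhds ?_
    have : ContinuousAt (fun t => c k / (a k + t)) 0 :=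
      continuousAt_const.div (by fun_prop) (by simpa using (h.pos_left k).ne')
    simpa [ContinuousAt] using this
  exact le_of_tendsto h1 (by filter_upwards [self_mem_nhdsWithin] with t ht using hB t ht)

theorem tendsto_prod_add (h : InterlacesToZero a b) {t : ℝ} (ht : 0 < t) :
    Tendsto (fun N => ∏ j ∈ Finset.range N, (b j + t) / (a j + t)) atTop
      (𝓝 (1 - ∑' k, limitWeight a b k / (a k + t))) := by
  simpa using h.tendsto_prod (neg_ne_zero.2 ht.ne')
    fun k => ((neg_lt_zero.2 ht).trans (h.pos_left k)).ne'

theorem summable_div_add (h : InterlacesToZero a b) {t : ℝ} (ht : 0 < t) :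
    Summable fun k => limitWeight a b k / (a k + t) := by
  simpa using h.summable_div_sub h.summable_limitWeight_div (neg_ne_zero.2 ht.ne')

/-- Both sides say that `∏ b j / a j` is zero. The poles accumulate at `0`, so the infinite
expansion is used at `-t` and then `t → 0`; adding `t` to numerator and denominator only increases
each factor. -/
theorem tsum_limitWeight_div_eq_one_iff (h : InterlacesToZero a b) :
    ∑' k, limitWeight a b k / a k = 1 ↔ SumEqTop fun j => 1 - b j / a j := by
  rw [← not_iff_not, not_sumEqTop_iff fun j =>
      sub_nonneg.2 ((div_le_one (h.pos_left j)).2 (h.lt j).le),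
    summable_iff_exists_le_prod_one_sub
      (fun j => sub_nonneg.2 ((div_le_one (h.pos_left j)).2 (h.lt j).le))
      (fun j => sub_lt_self _ (div_pos (h.pos j) (h.pos_left j)))]
  simp only [sub_sub_cancel]
  constructor
  · intro h1
    refine ⟨_, sub_pos.2 (lt_of_le_of_ne h.tsum_limitWeight_div_le h1), fun N => ?_⟩
    rw [h.prod_eq]
    refine sub_le_sub_left (le_trans ?_ (h.summable_limitWeight_div.sum_le_tsum
      (Finset.range N) fun k _ => h.limitWeight_div_nonneg k)) 1
    exact Finset.sum_le_sum fun k hk => div_le_div_of_nonneg_right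
      (h.cauchyWeight_le_limitWeight (Finset.mem_range.1 hk)) (h.pos_left k).le
  · rintro ⟨c, hc, h1⟩
    refine ne_of_lt (lt_of_le_of_lt (b := 1 - c) ?_ (by linarith))
    refine Real.tsum_le_of_sum_range_le h.limitWeight_div_nonneg fun n =>
      h.sum_div_le_of_forall_pos fun t ht => ?_
    have h2 : c ≤ 1 - ∑' k, limitWeight a b k / (a k + t) := by
      refine ge_of_tendsto (h.tendsto_prod_add ht) (Eventually.of_forall fun N => (h1 N).trans ?_)
      refine Finset.prod_le_prod (fun j _ => (div_pos (h.pos j) (h.pos_left j)).le) fun j _ => ?_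
      have := h.pos_left j
      rw [div_le_div_iff₀ this (by linarith)]
      nlinarith [h.lt j]
    have h3 := (h.summable_div_add ht).sum_le_tsum (Finset.range n) fun k _ =>
      (div_pos (h.limitWeight_pos k) (by linarith [h.pos_left k])).le
    linarith

/-- Pairing `b j` with `a (j + 1)` makes the factors at least `1` and isolates `b N + t`, which
tends to `t`. -/
theorem prod_add_succ (h : InterlacesToZero a b) {t : ℝ} (ht : 0 ≤ t) (N : ℕ) :
    ∏ j ∈ Finset.range (N + 1), (b j + t) / (a j + t) =
      (b N + t) / (a 0 + t) * ∏ j ∈ Finset.range N, (b j + t) / (a (j + 1) + t) := by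
  have h0 : ∀ j, a j + t ≠ 0 := fun j => (add_pos_of_pos_of_nonneg (h.pos_left j) ht).ne'
  rw [Finset.prod_div_distrib, Finset.prod_div_distrib, Finset.prod_range_succ,
    Finset.prod_range_succ', div_mul_div_comm, mul_comm (b N + t), mul_comm (a 0 + t)]

/-- By `h1`, `1 - ∑ r k / (a k + t) = t ∑ r k / (a k (a k + t))`, while the shifted product makes
the left side `t / (a 0 + t)` times `∏ (b j + t) / (a (j + 1) + t)`. Cancelling `t` and letting `t →
0` compares `∑ r k / a k ^ 2` with `(1 / a 0) ∏ b j / a (j + 1)`. -/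
theorem summable_limitWeight_div_sq_iff (h : InterlacesToZero a b)
    (h1 : ∑' k, limitWeight a b k / a k = 1) :
    (Summable fun k => limitWeight a b k / a k ^ 2) ↔
      ¬ SumEqTop fun j => b j / a (j + 1) - 1 := by
  have hy : ∀ j, 0 ≤ b j / a (j + 1) - 1 := fun j =>
    sub_nonneg.2 ((one_le_div (h.pos_left _)).2 (h.succ_lt j).le)
  rw [not_sumEqTop_iff hy, summable_iff_exists_prod_one_add_le hy]
  simp only [add_sub_cancel]
  have hterm : ∀ t > 0, ∀ k, limitWeight a b k / a k - limitWeight a b k / (a k + t) =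
      t * (limitWeight a b k / a k / (a k + t)) := fun t ht k => by
    have := h.pos_left k
    have : a k + t ≠ 0 := by linarith
    field_simp
    ring
  have hF : ∀ t > 0, HasSum (fun k => t * (limitWeight a b k / a k / (a k + t)))
      (1 - ∑' k, limitWeight a b k / (a k + t)) := fun t ht => by
    have := h.summable_limitWeight_div.hasSum.sub (h.summable_div_add ht).hasSum
    rw [h1] at this
    simpa only [hterm t ht] using this
  have hnn : ∀ t > 0, ∀ k, 0 ≤ limitWeight a b k / a k / (a k + t) := fun t ht k =>
    div_nonneg (h.limitWeight_div_nonneg k) (by linarith [h.pos_left k])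
  have hsq : ∀ k, limitWeight a b k / a k / a k = limitWeight a b k / a k ^ 2 := fun k => by
    rw [div_div, sq]
  have hanti : ∀ t > 0, Tendsto (fun N => ∏ j ∈ Finset.range (N + 1), (b j + t) / (a j + t)) atTop
      (𝓝 (1 - ∑' k, limitWeight a b k / (a k + t))) := fun t ht =>
    (tendsto_add_atTop_iff_nat 1).2 (h.tendsto_prod_add ht)
  constructor
  · intro hS
    refine ⟨a 0 * ∑' k, limitWeight a b k / a k ^ 2, fun N => ?_⟩
    have key : ∀ t > 0, ∏ j ∈ Finset.range N, (b j + t) / (a (j + 1) + t) ≤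
        (a 0 + t) * ∑' k, limitWeight a b k / a k ^ 2 := by
      intro t ht
      have ha0 : 0 < a 0 + t := by linarith [h.pos_left 0]
      have hpos : ∀ j, 0 < (b j + t) / (a (j + 1) + t) := fun j =>
        div_pos (by linarith [h.pos j]) (by linarith [h.pos_left (j + 1)])
      have h2 : t / (a 0 + t) * ∏ j ∈ Finset.range N, (b j + t) / (a (j + 1) + t) ≤
          1 - ∑' k, limitWeight a b k / (a k + t) := by
        refine ge_of_tendsto (hanti t ht) ((eventually_ge_atTop N).mono fun M hM => ?_)
        rw [h.prod_add_succ ht.le]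
        refine mul_le_mul ?_ ?_ (Finset.prod_nonneg fun j _ => (hpos j).le) ?_
        · exact div_le_div_of_nonneg_right (by linarith [h.pos M]) ha0.le
        · rw [← Finset.prod_range_mul_prod_Ico _ hM]
          refine le_mul_of_one_le_right (Finset.prod_nonneg fun j _ => (hpos j).le) ?_
          rw [← Finset.prod_const_one (s := Finset.Ico N M)]
          refine Finset.prod_le_prod (fun _ _ => zero_le_one) fun j _ => ?_
          rw [one_le_div (by linarith [h.pos_left (j + 1)])]
          linarith [h.succ_lt j]
        · exact div_nonneg (by linarith [h.pos M]) ha0.le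
      have h3 : 1 - ∑' k, limitWeight a b k / (a k + t) ≤
          t * ∑' k, limitWeight a b k / a k ^ 2 := by
        refine hasSum_le (fun k => mul_le_mul_of_nonneg_left ?_ ht.le) (hF t ht)
          (hS.hasSum.mul_left t)
        rw [← hsq]
        exact div_le_div_of_nonneg_left (h.limitWeight_div_nonneg k) (h.pos_left k) (by linarith)
      have h4 := h2.trans h3
      rw [div_mul_eq_mul_div, mul_div_assoc, mul_le_mul_iff_right₀ ht, div_le_iff₀ ha0] at h4
      linarith
    have hl : Tendsto (fun t => ∏ j ∈ Finset.range N, (b j + t) / (a (j + 1) + t)) (𝓝[>] (0 : ℝ))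
        (𝓝 (∏ j ∈ Finset.range N, b j / a (j + 1))) := by
      refine tendsto_finsetProd _ fun j _ => tendsto_nhdsWithin_of_tendsto_nhds ?_
      have : ContinuousAt (fun t => (b j + t) / (a (j + 1) + t)) 0 :=
        ContinuousAt.div (by fun_prop) (by fun_prop) (by simpa using (h.pos_left (j + 1)).ne')
      simpa [ContinuousAt] using this
    have hr : Tendsto (fun t => (a 0 + t) * ∑' k, limitWeight a b k / a k ^ 2) (𝓝[>] (0 : ℝ))
        (𝓝 (a 0 * ∑' k, limitWeight a b k / a k ^ 2)) := by
      refine tendsto_nhdsWithin_of_tendsto_nhds ?_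
      have : Continuous fun t => (a 0 + t) * ∑' k, limitWeight a b k / a k ^ 2 := by fun_prop
      simpa using this.tendsto 0
    exact le_of_tendsto_of_tendsto hl hr
      (by filter_upwards [self_mem_nhdsWithin] with t ht using key t ht)
  · rintro ⟨C, hC⟩
    have ha0 := h.pos_left 0
    have hC0 : 0 ≤ C := by simpa using zero_le_one.trans (hC 0)
    refine summable_of_sum_range_le (c := C / a 0)
      (fun k => div_nonneg (h.limitWeight_pos k).le (sq_nonneg _)) fun n => ?_
    simp only [← hsq]
    refine h.sum_div_le_of_forall_pos fun t ht => ?_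
    have h2 : 1 - ∑' k, limitWeight a b k / (a k + t) ≤ t * (C / a 0) := by
      have hl : Tendsto (fun N => (b N + t) * (C / a 0)) atTop (𝓝 ((0 + t) * (C / a 0))) :=
        (h.lim_right.add_const t).mul_const _
      rw [zero_add] at hl
      refine le_of_tendsto_of_tendsto' (hanti t ht) hl fun N => ?_
      have hbN : 0 < b N + t := by linarith [h.pos N]
      rw [h.prod_add_succ ht.le, div_mul_eq_mul_div, mul_div_assoc]
      refine mul_le_mul_of_nonneg_left (div_le_div₀ hC0 (le_trans ?_ (hC N)) ha0 (by linarith))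
        hbN.le
      refine Finset.prod_le_prod (fun j _ => ?_) fun j _ => ?_
      · exact div_nonneg (by linarith [h.pos j]) (by linarith [h.pos_left (j + 1)])
      · have := h.pos_left (j + 1)
        rw [div_le_div_iff₀ (by linarith) this]
        nlinarith [h.succ_lt j]
    have h3 := sum_le_hasSum (Finset.range n)
      (fun k _ => mul_nonneg ht.le (hnn t ht k)) (hF t ht)
    rw [← Finset.mul_sum] at h3
    exact le_of_mul_le_mul_left (h3.trans h2) ht

end InterlacesToZero

/-! ### Diagonal operators and rank one perturbations -/

section

open Module.End

/-- `W` acts as multiplication by `a` in the coordinates of the Hilbert basis `e`. -/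
def IsDiagonal {H : Type*} [NormedAddCommGroup H] [InnerProductSpace ℂ H]
    (e : HilbertBasis ℕ ℂ H) (W : H →L[ℂ] H) (a : ℕ → ℝ) : Prop :=
  ∀ x k, e.repr (W x) k = (a k : ℂ) * e.repr x k

section HilbertSpace

variable {H : Type*} [NormedAddCommGroup H] [InnerProductSpace ℂ H]

namespace HilbertBasis

theorem ext_repr (e : HilbertBasis ℕ ℂ H) {x y : H} (h : ∀ k, e.repr x k = e.repr y k) : x = y :=
  e.repr.injective (lp.ext (funext h))

theorem hasSum_norm_sq_repr (e : HilbertBasis ℕ ℂ H) (x : H) :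
    HasSum (fun k => ‖e.repr x k‖ ^ 2) (‖x‖ ^ 2) := by
  have h := lp.hasSum_norm (p := 2) (by norm_num) (e.repr x)
  simpa using h

theorem hasSum_inner_repr (e : HilbertBasis ℕ ℂ H) (x y : H) :
    HasSum (fun k => inner ℂ (e.repr x k) (e.repr y k)) (inner ℂ x y) := by
  rw [← e.repr.inner_map_map]
  exact lp.hasSum_inner _ _

theorem exists_repr_eq (e : HilbertBasis ℕ ℂ H) {f : ℕ → ℂ} (hf : Summable fun k => ‖f k‖ ^ 2) :
    ∃ x, ∀ k, e.repr x k = f k := by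
  have h : Memℓp f 2 := memℓp_gen (by simpa using hf)
  exact ⟨e.repr.symm ⟨f, h⟩, fun k => by simp⟩

theorem repr_self_apply (e : HilbertBasis ℕ ℂ H) (k j : ℕ) :
    e.repr (e k) j = if j = k then 1 else 0 := by
  rw [e.repr_self, lp.single_apply, Pi.single_apply]

theorem isSeparable (e : HilbertBasis ℕ ℂ H) : TopologicalSpace.SeparableSpace H := by
  rw [← TopologicalSpace.isSeparable_univ_iff]
  have h := (Set.countable_range e).isSeparable.span (R := ℂ) |>.closure
  have h2 := congrArg (fun S : Submodule ℂ H => (S : Set H)) e.dense_span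
  simp only [Submodule.topologicalClosure_coe, Submodule.top_coe] at h2
  rwa [h2] at h

/-- The operator with given bounded diagonal in a Hilbert basis. -/
theorem exists_isDiagonal (e : HilbertBasis ℕ ℂ H) {a : ℕ → ℝ} {C : ℝ} (hC : ∀ k, |a k| ≤ C) :
    ∃ W : H →L[ℂ] H, IsDiagonal e W a ∧ ‖W‖ ≤ C := by
  have hC0 : 0 ≤ C := (abs_nonneg _).trans (hC 0)
  have hle : ∀ x k, ‖(a k : ℂ) * e.repr x k‖ ^ 2 ≤ C ^ 2 * ‖e.repr x k‖ ^ 2 := fun x k => by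
    rw [norm_mul, mul_pow, Complex.norm_real]
    exact mul_le_mul_of_nonneg_right (pow_le_pow_left₀ (norm_nonneg _) (hC k) 2) (sq_nonneg _)
  have hs : ∀ x, Summable fun k => ‖(a k : ℂ) * e.repr x k‖ ^ 2 := fun x =>
    Summable.of_nonneg_of_le (fun k => sq_nonneg _) (hle x)
      ((e.hasSum_norm_sq_repr x).summable.mul_left _)
  choose f hf using fun x => e.exists_repr_eq (hs x)
  let L : H →ₗ[ℂ] H :=
    { toFun := f
      map_add' := fun x y => e.ext_repr fun k => by
        rw [map_add, lp.coeFn_add, Pi.add_apply, hf, hf, hf, map_add, lp.coeFn_add, Pi.add_apply,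
          mul_add]
      map_smul' := fun c x => e.ext_repr fun k => by
        rw [RingHom.id_apply, map_smul, lp.coeFn_smul, Pi.smul_apply, hf, hf, map_smul,
          lp.coeFn_smul, Pi.smul_apply, smul_eq_mul, smul_eq_mul, mul_left_comm] }
  have hL : ∀ x, ‖L x‖ ≤ C * ‖x‖ := fun x => by
    refine abs_le_of_sq_le_sq' ?_ (by positivity) |>.2
    rw [mul_pow]
    refine hasSum_le (fun k => ?_) (e.hasSum_norm_sq_repr (L x))
      ((e.hasSum_norm_sq_repr x).mul_left (C ^ 2))
    rw [show e.repr (L x) k = _ from hf x k]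
    exact hle x k
  exact ⟨L.mkContinuous C hL, hf, L.mkContinuous_norm_le hC0 hL⟩

end HilbertBasis

theorem isCompactOperator_rankOne (x y : H) :
    IsCompactOperator (InnerProductSpace.rankOne ℂ x y) := by
  have h : IsCompactOperator (innerSL ℂ y) :=
    isCompactOperator_of_locallyCompactSpace_dom (innerSL ℂ y)
  exact h.clm_comp (ContinuousLinearMap.toSpanSingleton ℂ x)

namespace IsDiagonal

variable {e : HilbertBasis ℕ ℂ H} {W : H →L[ℂ] H} {a : ℕ → ℝ}

theorem apply_basis (h : IsDiagonal e W a) (k : ℕ) : W (e k) = (a k : ℂ) • e k :=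
  e.ext_repr fun j => by
    rw [h, map_smul, lp.coeFn_smul, Pi.smul_apply, e.repr_self_apply, smul_eq_mul]
    split_ifs with hjk <;> simp [hjk]

theorem mem_eigenspace_iff (h : IsDiagonal e W a) {z : ℂ} {x : H} :
    x ∈ eigenspace (W : H →ₗ[ℂ] H) z ↔ ∀ k, (a k : ℂ) = z ∨ e.repr x k = 0 := by
  rw [Module.End.mem_eigenspace_iff]
  constructor
  · intro hx k
    have h1 := congrArg (fun y => e.repr y k) hx
    simp only [ContinuousLinearMap.coe_coe, h x k, map_smul, lp.coeFn_smul, Pi.smul_apply,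
      smul_eq_mul] at h1
    exact mul_eq_mul_right_iff.1 h1
  · intro hx
    refine e.ext_repr fun k => ?_
    simp only [ContinuousLinearMap.coe_coe, h x k, map_smul, lp.coeFn_smul, Pi.smul_apply,
      smul_eq_mul]
    exact mul_eq_mul_right_iff.2 (hx k)

theorem basis_mem_eigenspace (h : IsDiagonal e W a) (k : ℕ) :
    e k ∈ eigenspace (W : H →ₗ[ℂ] H) (a k : ℂ) :=
  Module.End.mem_eigenspace_iff.2 (h.apply_basis k)

theorem hasEigenvalue_iff (h : IsDiagonal e W a) (z : ℂ) :
    HasEigenvalue (W : H →ₗ[ℂ] H) z ↔ ∃ k, z = (a k : ℂ) := by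
  constructor
  · intro hz
    by_contra! hne
    obtain ⟨x, hx, hx0⟩ := hz.exists_hasEigenvector
    refine hx0 (e.ext_repr fun k => ?_)
    simpa using (h.mem_eigenspace_iff.1 hx k).resolve_left (hne k).symm
  · rintro ⟨k, rfl⟩
    exact hasEigenvalue_of_hasEigenvector ⟨h.basis_mem_eigenspace k, e.orthonormal.ne_zero k⟩

theorem finrank_eigenspace (h : IsDiagonal e W a) (ha : Function.Injective a) (k : ℕ) :
    Module.finrank ℂ (eigenspace (W : H →ₗ[ℂ] H) (a k : ℂ)) = 1 := by
  refine finrank_eq_one_iff'.2 ⟨⟨e k, h.basis_mem_eigenspace k⟩, fun h0 => ?_, fun x => ?_⟩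
  · exact e.orthonormal.ne_zero k (congrArg Subtype.val h0)
  · refine ⟨e.repr x k, Subtype.ext (e.ext_repr fun j => ?_)⟩
    simp only [Submodule.coe_smul, map_smul, lp.coeFn_smul, Pi.smul_apply, e.repr_self_apply,
      smul_eq_mul]
    split_ifs with hjk
    · simp [hjk]
    · rw [mul_zero, (h.mem_eigenspace_iff.1 x.2 j).resolve_left fun h1 =>
        hjk (ha (Complex.ofReal_injective h1))]

theorem ker_eq_bot (h : IsDiagonal e W a) (ha : ∀ k, a k ≠ 0) : (W : H →ₗ[ℂ] H).ker = ⊥ := by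
  refine LinearMap.ker_eq_bot'.2 fun x hx => e.ext_repr fun k => ?_
  have h1 := h x k
  rw [show W x = 0 from hx] at h1
  simpa [ha k] using h1.symm

theorem isPositive (h : IsDiagonal e W a) (ha : ∀ k, 0 ≤ a k) : W.IsPositive := by
  refine ⟨fun x y => ?_, fun x => ?_⟩
  · refine (e.hasSum_inner_repr (W x) y).unique ?_
    convert! e.hasSum_inner_repr x (W y) using 2 with k
    rw [h, h]
    simp only [RCLike.inner_apply, map_mul, Complex.conj_ofReal]
    ring
  · have h1 := (e.hasSum_inner_repr (W x) x).mapL Complex.reCLM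
    refine h1.nonneg fun k => ?_
    rw [h]
    have h2 : inner ℂ ((a k : ℂ) * e.repr x k) (e.repr x k) =
        ((a k * ‖e.repr x k‖ ^ 2 : ℝ) : ℂ) := by
      rw [← smul_eq_mul, inner_smul_left, inner_self_eq_norm_sq_to_K]
      simp
    rw [h2]
    exact mul_nonneg (ha k) (sq_nonneg _)

theorem isCompactOperator [CompleteSpace H] (h : IsDiagonal e W a) (ha : Tendsto a atTop (𝓝 0)) :
    IsCompactOperator W := by
  refine isCompactOperator_of_tendsto (l := atTop)
    (F := fun N => ∑ k ∈ Finset.range N, (a k : ℂ) • InnerProductSpace.rankOne ℂ (e k) (e k))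
    ?_ (Eventually.of_forall fun N => ?_)
  · rw [Metric.tendsto_atTop]
    intro ε hε
    obtain ⟨M, hM⟩ := eventually_atTop.1 (ha.eventually (Metric.ball_mem_nhds 0 (half_pos hε)))
    refine ⟨M, fun N hN => ?_⟩
    -- The remainder after truncation is diagonal with entries `a k`, `k ≥ N`, so its norm is at
    -- most `ε / 2`.
    obtain ⟨D, hD, hDn⟩ := e.exists_isDiagonal (a := fun k => if k < N then 0 else a k)
      (C := ε / 2) (fun k => by
        split_ifs with hk
        · simpa using (half_pos hε).le
        · simpa using (hM k (by omega)).le)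
    have hWD : D = W - ∑ k ∈ Finset.range N,
        (a k : ℂ) • InnerProductSpace.rankOne ℂ (e k) (e k) := by
      ext x
      refine e.ext_repr fun j => ?_
      have h1 : e.repr ((∑ k ∈ Finset.range N,
          (a k : ℂ) • InnerProductSpace.rankOne ℂ (e k) (e k)) x) j =
          if j < N then (a j : ℂ) * e.repr x j else 0 := by
        rw [e.repr_apply_apply]
        simp only [sum_apply, smul_apply, InnerProductSpace.rankOne_apply, inner_sum,
          inner_smul_right]
        simp only [← e.repr_apply_apply, e.repr_self_apply]
        simp
      rw [hD, sub_apply, map_sub, lp.coeFn_sub, Pi.sub_apply, h1, h]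
      split_ifs with hj <;> simp [hj]
    rw [dist_eq_norm, norm_sub_rev, ← hWD]
    linarith
  · have : ∀ s : Finset ℕ, IsCompactOperator
        (∑ k ∈ s, (a k : ℂ) • InnerProductSpace.rankOne ℂ (e k) (e k) : H →L[ℂ] H) := by
      intro s
      exact (compactOperator (RingHom.id ℂ) H H).sum_mem fun k _ =>
        Submodule.smul_mem _ _ (isCompactOperator_rankOne (e k) (e k))
    exact this _

/-- The secular equation for a rank one perturbation of a diagonal operator. -/
theorem hasEigenvalue_sub_rankOne_iff (h : IsDiagonal e W a) (ha : Tendsto a atTop (𝓝 0)) {p : H}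
    {z : ℝ} (hz : z ≠ 0) (hza : ∀ k, a k ≠ z) :
    HasEigenvalue ((W - InnerProductSpace.rankOne ℂ p p : H →L[ℂ] H) : H →ₗ[ℂ] H) (z : ℂ) ↔
      HasSum (fun k => ‖e.repr p k‖ ^ 2 / (a k - z)) 1 := by
  have hne : ∀ k, (a k : ℂ) - z ≠ 0 := fun k => by
    exact_mod_cast sub_ne_zero.2 (hza k)
  have hcoord : ∀ (c : ℂ) k, inner ℂ (e.repr p k) (c * e.repr p k / ((a k : ℂ) - z)) =
      c * ((‖e.repr p k‖ ^ 2 / (a k - z) : ℝ) : ℂ) := fun c k => by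
    have h1 : c * e.repr p k / ((a k : ℂ) - z) = (c / ((a k : ℂ) - z)) • e.repr p k := by
      rw [smul_eq_mul, div_mul_eq_mul_div]
    rw [h1, inner_smul_right, inner_self_eq_norm_sq_to_K]
    push_cast
    simp only [Complex.coe_algebraMap]
    ring
  have hmem : ∀ x, x ∈ eigenspace
      ((W - InnerProductSpace.rankOne ℂ p p : H →L[ℂ] H) : H →ₗ[ℂ] H) (z : ℂ) ↔
      ∀ k, e.repr x k = inner ℂ p x * e.repr p k / ((a k : ℂ) - z) := by
    intro x
    rw [Module.End.mem_eigenspace_iff]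
    have hk : ∀ k, e.repr x k = inner ℂ p x * e.repr p k / ((a k : ℂ) - z) ↔
        e.repr ((W - InnerProductSpace.rankOne ℂ p p) x) k = e.repr ((z : ℂ) • x) k := by
      intro k
      rw [eq_div_iff (hne k), sub_apply, InnerProductSpace.rankOne_apply,
        map_sub, map_smul, map_smul, lp.coeFn_sub, Pi.sub_apply, lp.coeFn_smul, lp.coeFn_smul,
        Pi.smul_apply, Pi.smul_apply, h, smul_eq_mul, smul_eq_mul]
      constructor <;> intro h1 <;> linear_combination h1
    simp only [hk]
    exact ⟨fun h1 k => congrArg (fun y => e.repr y k) h1, fun h1 => e.ext_repr h1⟩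
  constructor
  · intro hev
    -- An eigenvector is determined by the scalar `⟨p, x⟩`, which is therefore nonzero; pairing it
    -- with `p` and dividing by that scalar gives the secular equation.
    obtain ⟨x, hx, hx0⟩ := hev.exists_hasEigenvector
    rw [hmem] at hx
    have hc : inner ℂ p x ≠ 0 := fun hc => hx0 (e.ext_repr fun k => by
      rw [hx, hc]
      simp)
    have h1 := e.hasSum_inner_repr p x
    simp only [fun k => hx k, hcoord] at h1
    have h2 := h1.mul_left (inner ℂ p x)⁻¹
    simp only [inv_mul_cancel_left₀ hc, inv_mul_cancel₀ hc] at h2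
    exact Complex.hasSum_ofReal.1 (by simpa only [Complex.ofReal_one] using h2)
  · intro hs
    have hlim : Tendsto (fun k => |a k - z|⁻¹) atTop (𝓝 |0 - z|⁻¹) :=
      (ha.sub_const z).abs.inv₀ (by simpa using hz)
    obtain ⟨C, hC⟩ := (Metric.isBounded_range_of_tendsto _ hlim).exists_norm_le
    have hC : ∀ k, |a k - z|⁻¹ ≤ C := fun k => (le_abs_self _).trans (hC _ ⟨k, rfl⟩)
    obtain ⟨x, hx⟩ := e.exists_repr_eq (f := fun k => 1 * e.repr p k / ((a k : ℂ) - z)) (by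
      refine Summable.of_nonneg_of_le (fun k => sq_nonneg _) (fun k => ?_)
        ((e.hasSum_norm_sq_repr p).summable.mul_left (C ^ 2))
      have h1 : ‖(a k : ℂ) - z‖ = |a k - z| := by
        rw [← Complex.ofReal_sub, Complex.norm_real, Real.norm_eq_abs]
      rw [one_mul, norm_div, h1, div_eq_inv_mul, mul_pow]
      exact mul_le_mul_of_nonneg_right (pow_le_pow_left₀ (by positivity) (hC k) 2) (sq_nonneg _))
    have h1 := e.hasSum_inner_repr p x
    simp only [hx, hcoord] at h1
    simp only [one_mul] at h1
    have hpx : inner ℂ p x = 1 := h1.unique (by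
      simpa only [Complex.ofReal_one] using Complex.hasSum_ofReal.2 hs)
    refine hasEigenvalue_of_hasEigenvector (x := x) ⟨(hmem x).2 fun k => by rw [hx, hpx], ?_⟩
    rintro rfl
    simp at hpx

theorem mem_range_iff (h : IsDiagonal e W a) (ha : ∀ k, 0 < a k) (p : H) :
    p ∈ Set.range W ↔ Summable fun k => ‖e.repr p k‖ ^ 2 / a k ^ 2 := by
  have hnorm : ∀ k, ‖e.repr p k / (a k : ℂ)‖ ^ 2 = ‖e.repr p k‖ ^ 2 / a k ^ 2 := fun k => by
    rw [norm_div, div_pow, Complex.norm_real, Real.norm_of_nonneg (ha k).le]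
  have hne : ∀ k, (a k : ℂ) ≠ 0 := fun k => by exact_mod_cast (ha k).ne'
  constructor
  · rintro ⟨q, rfl⟩
    refine (e.hasSum_norm_sq_repr q).summable.congr fun k => ?_
    rw [← hnorm, h, mul_div_cancel_left₀ _ (hne k)]
  · intro hs
    obtain ⟨q, hq⟩ := e.exists_repr_eq (f := fun k => e.repr p k / (a k : ℂ))
      (by simpa only [hnorm] using hs)
    exact ⟨q, e.ext_repr fun k => by rw [h, hq, mul_div_cancel₀ _ (hne k)]⟩

end IsDiagonal

theorem normInv_eq_top_iff (A : H →L[ℂ] H) (p : H) : normInv A p = ⊤ ↔ p ∉ Set.range A := by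
  simp [normInv]

theorem normInv_apply {A : H →L[ℂ] H} (hA : Function.Injective A) (q : H) :
    normInv A (A q) = ‖q‖ₑ := by
  simp only [normInv, hA.eq_iff]
  exact iInf_iInf_eq_left

/-- The defect `v = √W x - √c x` satisfies `√W v = -√c v`, which positivity of `√W` allows only for
`v = 0`. -/
theorem apply_sqrt_of_apply_eq [CompleteSpace H] {W : H →L[ℂ] H} (hW : W.IsPositive) {x : H}
    {c : ℝ} (hc : 0 < c) (hx : W x = (c : ℂ) • x) : CFC.sqrt W x = ((√c : ℝ) : ℂ) • x := by
  have hW0 : 0 ≤ W := (ContinuousLinearMap.nonneg_iff_isPositive W).2 hW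
  have hS := (ContinuousLinearMap.nonneg_iff_isPositive _).1 (CFC.sqrt_nonneg W)
  have hSS : ∀ y, CFC.sqrt W (CFC.sqrt W y) = W y := fun y => by
    exact DFunLike.congr_fun (CFC.sqrt_mul_sqrt_self W hW0) y
  have hcc : ((√c : ℝ) : ℂ) * ((√c : ℝ) : ℂ) = c := by
    rw [← Complex.ofReal_mul, Real.mul_self_sqrt hc.le]
  set v := CFC.sqrt W x - ((√c : ℝ) : ℂ) • x with hv
  have hSv : CFC.sqrt W v = -(((√c : ℝ) : ℂ) • v) := by
    rw [hv, map_sub, map_smul, hSS, hx, smul_sub, smul_smul, hcc]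
    abel
  have h2 : (0 : ℝ) ≤ -(√c * ‖v‖ ^ 2) := by
    have h1 : 0 ≤ RCLike.re (inner ℂ (CFC.sqrt W v) v) := hS.2 v
    have h2 : inner ℂ (CFC.sqrt W v) v = ((-(√c * ‖v‖ ^ 2) : ℝ) : ℂ) := by
      rw [hSv, inner_neg_left, inner_smul_left, inner_self_eq_norm_sq_to_K, Complex.conj_ofReal]
      simp
    rw [h2] at h1
    exact h1
  have h3 : 0 < √c := Real.sqrt_pos.2 hc
  have h4 : ‖v‖ ^ 2 ≤ 0 := by nlinarith [sq_nonneg ‖v‖]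
  have h5 : ‖v‖ = 0 := by nlinarith [norm_nonneg v]
  exact sub_eq_zero.1 (norm_eq_zero.1 h5)

theorem isDiagonal_of_apply {e : HilbertBasis ℕ ℂ H} {W : H →L[ℂ] H} {a : ℕ → ℝ}
    (hW : W.IsPositive) (h : ∀ k, W (e k) = (a k : ℂ) • e k) : IsDiagonal e W a := fun x k => by
  rw [e.repr_apply_apply, e.repr_apply_apply, ← hW.isSymmetric.apply_clm, h, inner_smul_left,
    Complex.conj_ofReal]

theorem IsDiagonal.sqrt [CompleteSpace H] {e : HilbertBasis ℕ ℂ H} {W : H →L[ℂ] H} {a : ℕ → ℝ}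
    (h : IsDiagonal e W a) (ha : ∀ k, 0 < a k) : IsDiagonal e (CFC.sqrt W) fun k => √(a k) :=
  isDiagonal_of_apply ((ContinuousLinearMap.nonneg_iff_isPositive _).1 (CFC.sqrt_nonneg W))
    fun k => apply_sqrt_of_apply_eq (h.isPositive fun k => (ha k).le) (ha k) (h.apply_basis k)

/-- A compact positive operator with simple eigenvalues `a k` is diagonal in an eigenbasis in which
the coordinates of a given vector `p` are nonnegative. -/
theorem exists_isDiagonal_of_isCompactOperator [CompleteSpace H] {W : H →L[ℂ] H} {a : ℕ → ℝ}
    (hW : W.IsPositive) (hc : IsCompactOperator W) (ha : Function.Injective a)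
    (hev : ∀ z : ℂ, HasEigenvalue (W : H →ₗ[ℂ] H) z ↔ ∃ k, z = (a k : ℂ))
    (hsimple : ∀ k, Module.finrank ℂ (eigenspace (W : H →ₗ[ℂ] H) (a k : ℂ)) = 1) (p : H) :
    ∃ e : HilbertBasis ℕ ℂ H, IsDiagonal e W a ∧ ∀ k, e.repr p k = (‖e.repr p k‖ : ℂ) := by
  have hv : ∀ k, ∃ v : H, ‖v‖ = 1 ∧ v ∈ eigenspace (W : H →ₗ[ℂ] H) (a k : ℂ) ∧
      inner ℂ v p = (‖inner ℂ v p‖ : ℂ) := by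
    intro k
    obtain ⟨x, hx, hx0⟩ := ((hev _).2 ⟨k, rfl⟩).exists_hasEigenvector
    -- Rotating the eigenvector by the phase of `⟨x, p⟩` makes the coordinate of `p` nonnegative; a
    -- simple eigenvalue leaves no other freedom after normalising the length.
    obtain ⟨c, hc1, hc2⟩ : ∃ c : ℂ, ‖c‖ = 1 ∧
        inner ℂ (c • x) p = (‖inner ℂ x p‖ : ℂ) := by
      by_cases h0 : inner ℂ x p = 0
      · exact ⟨1, by simp, by simp [h0]⟩
      · have h0' : ‖inner ℂ x p‖ ≠ 0 := norm_ne_zero_iff.2 h0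
        refine ⟨inner ℂ x p / ‖inner ℂ x p‖, by simp [h0'], ?_⟩
        rw [inner_smul_left, map_div₀, Complex.conj_ofReal, div_mul_eq_mul_div, RCLike.conj_mul]
        have : ((‖inner ℂ x p‖ : ℝ) : ℂ) ≠ 0 := by exact_mod_cast h0'
        rw [div_eq_iff this, sq]
        rfl
    have hxn : ‖x‖ ≠ 0 := norm_ne_zero_iff.2 hx0
    refine ⟨((‖x‖⁻¹ : ℝ) : ℂ) • c • x, ?_, ?_, ?_⟩
    · rw [norm_smul, norm_smul, hc1, Complex.norm_real, norm_inv, norm_norm, one_mul,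
        inv_mul_cancel₀ hxn]
    · exact Submodule.smul_mem _ _ (Submodule.smul_mem _ _ hx)
    · rw [inner_smul_left, hc2, Complex.conj_ofReal, ← Complex.ofReal_mul, Complex.norm_real,
        Real.norm_of_nonneg (by positivity)]
  choose v hv1 hv2 hv3 using hv
  have horth : Orthonormal ℂ v := by
    refine ⟨hv1, fun i j hij => ?_⟩
    exact hW.isSymmetric.orthogonalFamily_eigenspaces
      (fun h => hij (ha (Complex.ofReal_injective h))) ⟨v i, hv2 i⟩ ⟨v j, hv2 j⟩
  have hspan : (Submodule.span ℂ (Set.range v))ᗮ = ⊥ := by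
    rw [eq_bot_iff,
      ← ContinuousLinearMap.orthogonalComplement_iSup_eigenspaces_eq_bot hc hW.isSymmetric]
    refine Submodule.orthogonal_le (iSup_le fun z => ?_)
    by_cases hz : HasEigenvalue (W : H →ₗ[ℂ] H) z
    · obtain ⟨k, rfl⟩ := (hev z).1 hz
      intro y hy
      have hvk : (⟨v k, hv2 k⟩ : eigenspace (W : H →ₗ[ℂ] H) (a k : ℂ)) ≠ 0 := fun h0 => by
        have := hv1 k
        rw [show v k = 0 from congrArg Subtype.val h0] at this
        simp at this
      obtain ⟨c, hc⟩ := (finrank_eq_one_iff_of_nonzero' _ hvk).1 (hsimple k) ⟨y, hy⟩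
      rw [← show c • v k = y from congrArg Subtype.val hc]
      exact Submodule.smul_mem _ _ (Submodule.subset_span ⟨k, rfl⟩)
    · rw [Module.End.HasEigenvalue, Module.End.HasUnifEigenvalue, not_not] at hz
      exact (le_of_eq hz).trans bot_le
  refine ⟨HilbertBasis.mkOfOrthogonalEqBot horth hspan, ?_, fun k => ?_⟩
  · refine isDiagonal_of_apply hW fun k => ?_
    rw [HilbertBasis.coe_mkOfOrthogonalEqBot]
    exact Module.End.mem_eigenspace_iff.1 (hv2 k)
  · rw [HilbertBasis.repr_apply_apply, HilbertBasis.coe_mkOfOrthogonalEqBot]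
    exact hv3 k

end HilbertSpace

/-! ### Existence, canonical form and properties of the triple -/

theorem InterlacesToZero.of_abs {lam mu : ℕ → ℝ}
    (h_lam_mu : ∀ k, |mu k| < |lam k|) (h_mu_lam : ∀ k, |lam (k + 1)| < |mu k|)
    (h_lim : Tendsto (fun k => lam k ^ 2) atTop (𝓝 0)) :
    InterlacesToZero (fun k => lam k ^ 2) (fun k => mu k ^ 2) where
  lt k := sq_lt_sq.2 (h_lam_mu k)
  succ_lt k := sq_lt_sq.2 (h_mu_lam k)
  pos k := by
    have h := (abs_nonneg _).trans_lt (h_mu_lam k)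
    have h0 : mu k ≠ 0 := abs_pos.1 h
    positivity
  lim := h_lim

/-- If `∑ r k / (a k + t)` never equals `1` for `t > 0`, then `∑ r k / a k ≤ 1`. -/
theorem InterlacesToZero.sum_div_le_one {a b r : ℕ → ℝ} (h : InterlacesToZero a b)
    (hr : ∀ k, 0 ≤ r k) (hs : Summable r)
    (hne : ∀ t > 0, ¬ HasSum (fun k => r k / (a k + t)) 1) (n : ℕ) :
    ∑ k ∈ Finset.range n, r k / a k ≤ 1 := by
  refine h.sum_div_le_of_forall_pos fun t ht => ?_
  by_contra! h1
  have hle : ∀ s > 0, ∀ x, s ≤ x → ∀ k, r k / (a k + x) ≤ r k / s := fun s hs x hx k =>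
    div_le_div_of_nonneg_left (hr k) hs (by linarith [h.pos_left k])
  have hnn : ∀ x > 0, ∀ k, 0 ≤ r k / (a k + x) := fun x hx k =>
    div_nonneg (hr k) (by linarith [h.pos_left k])
  have hsum : ∀ x > 0, Summable fun k => r k / (a k + x) := fun x hx =>
    Summable.of_nonneg_of_le (hnn x hx) (hle x hx x le_rfl) (hs.div_const x)
  -- Past `∑ r k` the sum is at most `1`, while at `t` it is at least `1`; the intermediate value
  -- theorem then yields a forbidden solution.
  set T := max t (∑' k, r k) with hT
  have hT0 : 0 < T := ht.trans_le (le_max_left _ _)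
  have hcont : ContinuousOn (fun x => ∑' k, r k / (a k + x)) (Set.Icc t T) := by
    refine continuousOn_tsum (fun k => ?_) (hs.div_const t) fun k x hx => ?_
    · refine ContinuousOn.div (by fun_prop) (by fun_prop) fun x hx => ?_
      have := h.pos_left k
      have := hx.1
      linarith
    · rw [Real.norm_of_nonneg (hnn x (ht.trans_le hx.1) k)]
      exact hle t ht x hx.1 k
  have h2 : ∑' k, r k / (a k + T) ≤ 1 := by
    refine ((hsum T hT0).tsum_le_tsum (hle T hT0 T le_rfl) (hs.div_const T)).trans ?_
    rw [tsum_div_const, div_le_one hT0]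
    exact le_max_right _ _
  have h3 : 1 ≤ ∑' k, r k / (a k + t) :=
    h1.le.trans ((hsum t ht).sum_le_tsum _ fun k _ => hnn t ht k)
  obtain ⟨x, hx, hx1⟩ := intermediate_value_Icc' (le_max_left _ _) hcont ⟨h2, h3⟩
  have hx0 : 0 < x := ht.trans_le hx.1
  exact hne x hx0 ((hsum x hx0).hasSum_iff.2 hx1)

theorem InterlacesToZero.summable_limitWeight {a b : ℕ → ℝ} (h : InterlacesToZero a b) :
    Summable (limitWeight a b) := by
  refine Summable.of_nonneg_of_le (fun k => (h.limitWeight_pos k).le) (fun k => ?_)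
    (h.summable_limitWeight_div.mul_left (a 0))
  have h1 := h.pos_left k
  rw [mul_div_assoc', le_div_iff₀ h1, mul_comm]
  exact mul_le_mul_of_nonneg_right (h.strictAnti.antitone k.zero_le) (h.limitWeight_pos k).le

section HilbertSpace

variable {H : Type*} [NormedAddCommGroup H] [InnerProductSpace ℂ H]

/-- Eigenvalues of a rank one perturbation `W - p p^*` that are not eigenvalues of `W` are
simple. -/
theorem finrank_eigenspace_sub_rankOne {W : H →L[ℂ] H} {p : H} {z : ℂ}
    (hW : ¬ HasEigenvalue (W : H →ₗ[ℂ] H) z)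
    (hz : HasEigenvalue ((W - InnerProductSpace.rankOne ℂ p p : H →L[ℂ] H) : H →ₗ[ℂ] H) z) :
    Module.finrank ℂ
      (eigenspace ((W - InnerProductSpace.rankOne ℂ p p : H →L[ℂ] H) : H →ₗ[ℂ] H) z) = 1 := by
  set E := eigenspace ((W - InnerProductSpace.rankOne ℂ p p : H →L[ℂ] H) : H →ₗ[ℂ] H) z with hE
  -- On the kernel of `x ↦ ⟨p, x⟩` the perturbation vanishes, so a nonzero kernel vector would be an
  -- eigenvector of `W`.
  let f : E →ₗ[ℂ] ℂ := (innerₛₗ ℂ p).comp E.subtype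
  have hf : Function.Injective f := by
    rw [← LinearMap.ker_eq_bot, LinearMap.ker_eq_bot']
    rintro ⟨x, hx⟩ hfx
    have hpx : inner ℂ p x = 0 := hfx
    have h1 : (W - InnerProductSpace.rankOne ℂ p p) x = z • x := Module.End.mem_eigenspace_iff.1 hx
    rw [sub_apply, InnerProductSpace.rankOne_apply, hpx, zero_smul, sub_zero] at h1
    by_contra hx0
    exact hW (hasEigenvalue_of_hasEigenvector
      ⟨Module.End.mem_eigenspace_iff.2 h1, fun h => hx0 (Subtype.ext h)⟩)
  have : FiniteDimensional ℂ E := FiniteDimensional.of_injective f hf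
  have h1 := LinearMap.finrank_le_finrank_of_injective hf
  rw [Module.finrank_self] at h1
  have : Nontrivial E := Submodule.nontrivial_iff_ne_bot.2 hz
  have h2 : 0 < Module.finrank ℂ E := Module.finrank_pos
  omega

/-- The `k`-th coordinate of the eigenvalue equation forces `⟨p, x⟩ = 0`. Then `x` is an eigenvector
of `W`, hence a multiple of `e k`, and `⟨p, x⟩ = 0` makes it zero. -/
theorem IsDiagonal.not_hasEigenvalue_sub_rankOne {e : HilbertBasis ℕ ℂ H} {W : H →L[ℂ] H}
    {a : ℕ → ℝ} (h : IsDiagonal e W a) (ha : Function.Injective a) {p : H} {k : ℕ}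
    (hp : e.repr p k ≠ 0) :
    ¬ HasEigenvalue ((W - InnerProductSpace.rankOne ℂ p p : H →L[ℂ] H) : H →ₗ[ℂ] H)
      (a k : ℂ) := by
  intro hev
  obtain ⟨x, hx, hx0⟩ := hev.exists_hasEigenvector
  have h1 : (W - InnerProductSpace.rankOne ℂ p p) x = (a k : ℂ) • x :=
    Module.End.mem_eigenspace_iff.1 hx
  have hpx : inner ℂ p x = 0 := by
    have h2 := congrArg (fun y => e.repr y k) h1
    simp only [sub_apply, InnerProductSpace.rankOne_apply, map_sub, map_smul, lp.coeFn_sub,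
      lp.coeFn_smul, Pi.sub_apply, Pi.smul_apply, h x k, smul_eq_mul] at h2
    exact (mul_eq_zero.1 (sub_eq_self.1 h2)).resolve_right hp
  rw [sub_apply, InnerProductSpace.rankOne_apply, hpx, zero_smul, sub_zero] at h1
  have hxj : ∀ j ≠ k, e.repr x j = 0 := fun j hj =>
    (h.mem_eigenspace_iff.1 (Module.End.mem_eigenspace_iff.2 h1) j).resolve_left
      fun h2 => hj (ha (Complex.ofReal_injective h2))
  have h2 : inner ℂ p x = inner ℂ (e.repr p k) (e.repr x k) :=
    (e.hasSum_inner_repr p x).unique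
      (hasSum_single k fun j hj => by rw [hxj j hj, inner_zero_right])
  rw [hpx, RCLike.inner_apply, eq_comm, mul_eq_zero, map_eq_zero] at h2
  refine hx0 (e.ext_repr fun j => ?_)
  by_cases hj : j = k
  · subst hj
    simpa using h2.resolve_right hp
  · simpa using hxj j hj

/-- The canonical form of a triple: in a suitable eigenbasis of `W`, the coordinates of `p` are the
square roots of the residues of the product `∏ j, (mu j ^ 2 - z) / (lam j ^ 2 - z)`. -/
theorem IsBorgTriple.exists_isDiagonal [CompleteSpace H] {lam mu : ℕ → ℝ} {W W₁ : H →L[ℂ] H} {p : H}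
    (h : InterlacesToZero (fun k => lam k ^ 2) (fun k => mu k ^ 2))
    (t : IsBorgTriple lam mu W W₁ p) :
    ∃ e : HilbertBasis ℕ ℂ H, IsDiagonal e W (fun k => lam k ^ 2) ∧ ∀ k, e.repr p k =
      ((√(limitWeight (fun k => lam k ^ 2) (fun k => mu k ^ 2) k) : ℝ) : ℂ) := by
  obtain ⟨e, he, hp⟩ := exists_isDiagonal_of_isCompactOperator t.isPositive t.isCompact
    h.strictAnti.injective t.hasEigenvalue_iff t.simple p
  refine ⟨e, he, fun k => ?_⟩
  have hev := fun z (hz : z ≠ 0) hza => he.hasEigenvalue_sub_rankOne_iff h.lim (p := p) (z := z)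
    hz hza
  simp only [← t.eq_sub] at hev
  -- A solution of the secular equation at `-x < 0` would be a negative eigenvalue of `W₁`, but its
  -- nonzero eigenvalues are squares.
  have hle := h.sum_div_le_one (r := fun k => ‖e.repr p k‖ ^ 2) (fun k => sq_nonneg _)
    (e.hasSum_norm_sq_repr p).summable fun x hx hs => by
      have hx0 : -x ≠ 0 := neg_ne_zero.2 hx.ne'
      have h1 := (hev (-x) hx0 fun k => ((neg_lt_zero.2 hx).trans (h.pos_left k)).ne').2
        (by simpa only [sub_neg_eq_add] using hs)
      obtain ⟨j, hj⟩ := (t.hasEigenvalue₁_iff _ (by exact_mod_cast hx0)).1 h1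
      have := Complex.ofReal_injective hj
      linarith [sq_nonneg (mu j)]
  have hnn : ∀ k, 0 ≤ ‖e.repr p k‖ ^ 2 / lam k ^ 2 := fun k => by positivity
  have key := h.eq_limitWeight (fun k => sq_nonneg ‖e.repr p k‖)
    (summable_of_sum_range_le hnn hle) (Real.tsum_le_of_sum_range_le hnn hle)
    (fun j => (hev _ (h.pos j).ne' fun k => h.ne k j).1
      ((t.hasEigenvalue₁_iff _ (by exact_mod_cast (h.pos j).ne')).2 ⟨j, rfl⟩)) k
  rw [← key, Real.sqrt_sq (norm_nonneg _)]
  exact hp k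

end HilbertSpace

theorem InterlacesToZero.exists_isBorgTriple {lam mu : ℕ → ℝ}
    (h : InterlacesToZero (fun k => lam k ^ 2) (fun k => mu k ^ 2)) :
    ∃ (W W₁ : lp (fun _ : ℕ => ℂ) 2 →L[ℂ] lp (fun _ : ℕ => ℂ) 2) (p : lp (fun _ : ℕ => ℂ) 2),
      IsBorgTriple lam mu W W₁ p := by
  let e : HilbertBasis ℕ ℂ (lp (fun _ : ℕ => ℂ) 2) := ⟨LinearIsometryEquiv.refl ℂ _⟩
  obtain ⟨W, hW, -⟩ := e.exists_isDiagonal (a := fun k => lam k ^ 2) (C := lam 0 ^ 2) fun k => by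
    rw [abs_of_pos (h.pos_left k)]
    exact h.strictAnti.antitone k.zero_le
  set ρ := limitWeight (fun k => lam k ^ 2) (fun k => mu k ^ 2) with hρ
  have hnorm : ∀ k, ‖((√(ρ k) : ℝ) : ℂ)‖ ^ 2 = ρ k := fun k => by
    rw [Complex.norm_real, Real.norm_of_nonneg (Real.sqrt_nonneg _),
      Real.sq_sqrt (h.limitWeight_pos k).le]
  obtain ⟨p, hp⟩ := e.exists_repr_eq (f := fun k => ((√(ρ k) : ℝ) : ℂ))
    (by simpa only [hnorm] using h.summable_limitWeight)
  have hpos := hW.isPositive fun k => (h.pos_left k).le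
  have hcomp := hW.isCompactOperator h.lim
  have hsymm : ((W - InnerProductSpace.rankOne ℂ p p :
      lp (fun _ : ℕ => ℂ) 2 →L[ℂ] lp (fun _ : ℕ => ℂ) 2) :
      lp (fun _ : ℕ => ℂ) 2 →ₗ[ℂ] lp (fun _ : ℕ => ℂ) 2).IsSymmetric :=
    hpos.isSymmetric.sub (InnerProductSpace.isSymmetric_rankOne_self p)
  have hev : ∀ x : ℝ, x ≠ 0 → (∀ k, lam k ^ 2 ≠ x) → (HasEigenvalue
      ((W - InnerProductSpace.rankOne ℂ p p :
        lp (fun _ : ℕ => ℂ) 2 →L[ℂ] lp (fun _ : ℕ => ℂ) 2) :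
        lp (fun _ : ℕ => ℂ) 2 →ₗ[ℂ] lp (fun _ : ℕ => ℂ) 2) (x : ℂ) ↔ ∃ k, x = mu k ^ 2) := by
    intro x hx hxa
    rw [hW.hasEigenvalue_sub_rankOne_iff h.lim hx hxa, ← h.hasSum_limitWeight_iff hx hxa]
    simp only [hp, hnorm]
    exact Iff.rfl
  refine ⟨W, _, p, hpos, hW.ker_eq_bot fun k => (h.pos_left k).ne', hcomp, hW.hasEigenvalue_iff,
    hW.finrank_eigenspace h.strictAnti.injective, rfl,
    hcomp.sub (isCompactOperator_rankOne p p), fun z hz => ?_⟩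
  constructor
  · intro hzev
    obtain ⟨x, rfl⟩ := Complex.conj_eq_iff_real.1 (hsymm.conj_eigenvalue_eq_self hzev)
    obtain ⟨k, hk⟩ := (hev x (by exact_mod_cast hz) fun k hk => by
      subst hk
      refine hW.not_hasEigenvalue_sub_rankOne h.strictAnti.injective ?_ hzev
      rw [hp]
      exact Complex.ofReal_ne_zero.2 (Real.sqrt_pos.2 (h.limitWeight_pos k)).ne').1 hzev
    exact ⟨k, by rw [hk]⟩
  · rintro ⟨k, rfl⟩
    exact (hev _ (h.pos k).ne' fun j => h.ne j k).2 ⟨k, rfl⟩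

/-- Both triples have the same coordinates in their canonical eigenbases, so `U` maps one basis to
the other. -/
theorem IsBorgTriple.unitaryEquiv {lam mu : ℕ → ℝ}
    (h : InterlacesToZero (fun k => lam k ^ 2) (fun k => mu k ^ 2))
    {H : Type*} [NormedAddCommGroup H] [InnerProductSpace ℂ H] [CompleteSpace H]
    {H' : Type*} [NormedAddCommGroup H'] [InnerProductSpace ℂ H'] [CompleteSpace H']
    {W W₁ : H →L[ℂ] H} {p : H} {W' W₁' : H' →L[ℂ] H'} {p' : H'}
    (t : IsBorgTriple lam mu W W₁ p) (t' : IsBorgTriple lam mu W' W₁' p') :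
    TripleUnitaryEquiv W W₁ p W' W₁' p' := by
  obtain ⟨e, he, hp⟩ := t.exists_isDiagonal h
  obtain ⟨e', he', hp'⟩ := t'.exists_isDiagonal h
  let U : H ≃ₗᵢ[ℂ] H' := e.repr.trans e'.repr.symm
  have hU : ∀ x, e'.repr (U x) = e.repr x := fun x => e'.repr.apply_symm_apply _
  have hUW : ∀ x, W' (U x) = U (W x) := fun x => e'.ext_repr fun k => by
    rw [he', hU, hU, he]
  have hUp : p' = U p := e'.ext_repr fun k => by rw [hU, hp, hp']
  have hW : ∀ y, W' y = U (W (U.symm y)) := fun y => by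
    rw [← hUW, U.apply_symm_apply]
  refine ⟨U, hW, fun y => ?_, hUp⟩
  rw [t.eq_sub, t'.eq_sub, sub_apply, sub_apply, map_sub, ← hW, InnerProductSpace.rankOne_apply,
    InnerProductSpace.rankOne_apply, map_smul, hUp]
  congr 2
  rw [← U.inner_map_map, U.apply_symm_apply]

namespace IsBorgTriple

variable {lam mu : ℕ → ℝ} {H : Type*} [NormedAddCommGroup H] [InnerProductSpace ℂ H]
  [CompleteSpace H] {W W₁ : H →L[ℂ] H} {p : H}

/-- `W` and `W₁` share no eigenvalue: the nonzero ones interlace strictly, and `0` is not an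
eigenvalue of `W`. -/
theorem finrank_eigenspace (h : InterlacesToZero (fun k => lam k ^ 2) (fun k => mu k ^ 2))
    (t : IsBorgTriple lam mu W W₁ p) {z : ℂ} (hz : HasEigenvalue (W₁ : H →ₗ[ℂ] H) z) :
    Module.finrank ℂ (eigenspace (W₁ : H →ₗ[ℂ] H) z) = 1 := by
  have hW : ¬ HasEigenvalue (W : H →ₗ[ℂ] H) z := fun hzW => by
    obtain ⟨k, rfl⟩ := (t.hasEigenvalue_iff z).1 hzW
    obtain ⟨j, hj⟩ := (t.hasEigenvalue₁_iff _ (by exact_mod_cast (h.pos_left k).ne')).1 hz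
    exact h.ne k j (Complex.ofReal_injective hj)
  rw [t.eq_sub] at hz ⊢
  exact finrank_eigenspace_sub_rankOne hW hz

/-- Summability of `ρ k / lam k ^ 2` always puts `p` in the range of `√W`, with a preimage whose
squared norm is that sum. -/
theorem normInv_sqrt_eq_one_iff (h : InterlacesToZero (fun k => lam k ^ 2) (fun k => mu k ^ 2))
    (t : IsBorgTriple lam mu W W₁ p) :
    normInv (CFC.sqrt W) p = 1 ↔ SumEqTop fun j => 1 - mu j ^ 2 / lam j ^ 2 := by
  obtain ⟨e, he, hp⟩ := t.exists_isDiagonal h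
  rw [← h.tsum_limitWeight_div_eq_one_iff]
  set ρ := limitWeight (fun k => lam k ^ 2) (fun k => mu k ^ 2) with hρ
  have hS : IsDiagonal e (CFC.sqrt W) fun k => √(lam k ^ 2) := IsDiagonal.sqrt he h.pos_left
  have hsqrt : ∀ k, 0 < √(lam k ^ 2) := fun k => Real.sqrt_pos.2 (h.pos_left k)
  have hinj : Function.Injective (CFC.sqrt W : H →L[ℂ] H) :=
    LinearMap.ker_eq_bot.1 (IsDiagonal.ker_eq_bot hS fun k => (hsqrt k).ne')
  have hnorm : ∀ k, ‖((√(ρ k) / √(lam k ^ 2) : ℝ) : ℂ)‖ ^ 2 = ρ k / lam k ^ 2 := fun k => by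
    rw [Complex.norm_real, Real.norm_of_nonneg (by positivity), div_pow,
      Real.sq_sqrt (h.limitWeight_pos k).le, Real.sq_sqrt (h.pos_left k).le]
  obtain ⟨q, hq⟩ := e.exists_repr_eq (f := fun k => ((√(ρ k) / √(lam k ^ 2) : ℝ) : ℂ))
    (by simpa only [hnorm] using h.summable_limitWeight_div)
  have hSq : CFC.sqrt W q = p := e.ext_repr fun k => by
    rw [hS, hq, hp, ← Complex.ofReal_mul, mul_div_cancel₀ _ (hsqrt k).ne']
  have hqn := e.hasSum_norm_sq_repr q
  simp only [hq, hnorm] at hqn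
  rw [← hSq, normInv_apply hinj, hqn.tsum_eq, pow_eq_one_iff_of_nonneg (norm_nonneg q) two_ne_zero,
    ← ofReal_norm, ENNReal.ofReal_eq_one]

theorem notMem_range_iff (h : InterlacesToZero (fun k => lam k ^ 2) (fun k => mu k ^ 2))
    (t : IsBorgTriple lam mu W W₁ p) (hs : SumEqTop fun j => 1 - mu j ^ 2 / lam j ^ 2) :
    p ∉ Set.range W ↔ SumEqTop fun j => mu j ^ 2 / lam (j + 1) ^ 2 - 1 := by
  obtain ⟨e, he, hp⟩ := t.exists_isDiagonal h
  rw [he.mem_range_iff h.pos_left, ← not_iff_not, not_not,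
    ← h.summable_limitWeight_div_sq_iff (h.tsum_limitWeight_div_eq_one_iff.2 hs)]
  refine iff_of_eq (congrArg Summable (funext fun k => ?_))
  rw [hp, Complex.norm_real, Real.norm_of_nonneg (Real.sqrt_nonneg _),
    Real.sq_sqrt (h.limitWeight_pos k).le]

end IsBorgTriple

end

theorem theorem3p1 (lam mu : ℕ → ℝ)
    (h_lam_mu : ∀ k, |mu k| < |lam k|) (h_mu_lam : ∀ k, |lam (k + 1)| < |mu k|)
    (h_lim : Tendsto (fun k => lam k ^ 2) atTop (𝓝 0)) :
    -- existence
    (∃ (H : Type) (_ : NormedAddCommGroup H) (_ : InnerProductSpace ℂ H) (_ : CompleteSpace H)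
        (_ : TopologicalSpace.SeparableSpace H) (W W₁ : H →L[ℂ] H) (p : H),
        IsBorgTriple lam mu W W₁ p) ∧
    -- uniqueness up to unitary equivalence
    (∀ (H : Type*) [NormedAddCommGroup H] [InnerProductSpace ℂ H] [CompleteSpace H]
        (H' : Type*) [NormedAddCommGroup H'] [InnerProductSpace ℂ H'] [CompleteSpace H']
        (W W₁ : H →L[ℂ] H) (p : H) (W' W₁' : H' →L[ℂ] H') (p' : H'),
        IsBorgTriple lam mu W W₁ p → IsBorgTriple lam mu W' W₁' p' →
        TripleUnitaryEquiv W W₁ p W' W₁' p') ∧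
    -- further properties of the triple
    (∀ (H : Type*) [NormedAddCommGroup H] [InnerProductSpace ℂ H] [CompleteSpace H]
        (W W₁ : H →L[ℂ] H) (p : H), IsBorgTriple lam mu W W₁ p →
        (∀ z : ℂ, Module.End.HasEigenvalue (W₁ : H →ₗ[ℂ] H) z →
          Module.finrank ℂ (Module.End.eigenspace (W₁ : H →ₗ[ℂ] H) z) = 1) ∧
        (normInv (CFC.sqrt W) p = 1 ↔ SumEqTop fun j => 1 - mu j ^ 2 / lam j ^ 2) ∧
        (SumEqTop (fun j => 1 - mu j ^ 2 / lam j ^ 2) →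
          (normInv W p = ⊤ ↔ SumEqTop fun j => mu j ^ 2 / lam (j + 1) ^ 2 - 1) ∧
          (p ∉ Set.range W ↔ SumEqTop fun j => mu j ^ 2 / lam (j + 1) ^ 2 - 1))) := by
  have h := InterlacesToZero.of_abs h_lam_mu h_mu_lam h_lim
  refine ⟨?_, ?_, ?_⟩
  · obtain ⟨W, W₁, p, t⟩ := h.exists_isBorgTriple
    exact ⟨lp (fun _ : ℕ => ℂ) 2, inferInstance, inferInstance, inferInstance,
      HilbertBasis.isSeparable ⟨LinearIsometryEquiv.refl ℂ _⟩, W, W₁, p, t⟩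
  · intro H _ _ _ H' _ _ _ W W₁ p W' W₁' p' t t'
    exact t.unitaryEquiv h t'
  · intro H _ _ _ W W₁ p t
    refine ⟨fun z hz => t.finrank_eigenspace h hz, t.normInv_sqrt_eq_one_iff h, fun hs => ?_⟩
    rw [normInv_eq_top_iff]
    exact ⟨t.notMem_range_iff h hs, t.notMem_range_iff h hs⟩
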